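/- Let $V=\mathbb R^4$, let $\mathbb S^3=(V\setminus\{0\})/\mathbb R_+$ be the projective sphere, and let $\mathrm{SL}_\pm(4,\mathbb R)$ be the group of linear automorphisms of $V$ of determinant $\pm1$. Let $\mathcal G$ be the labeled combinatorial 3-polytope with six facets $\mathcal G_1,\dots,\mathcal G_6$ obtained from a triangular prism with lateral facets $\mathcal G_1,\mathcal G_2,\mathcal G_3$ and bases $\mathcal G_4,\mathcal G_5$ by truncating the vertex $\mathcal G_1\cap\mathcal G_2\cap\mathcal G_5$, the new triangular facet being $\mathcal G_6$. The integers $m_{i,j}$ assigned to its twelve edges $\mathcal G_i\cap\mathcal G_j$ are $$m_{1,4}=m_{1,6}=m_{2,4}=m_{2,6}=m_{3,5}=2,\quad m_{1,2}=m_{1,3}=m_{1,5}=m_{2,5}=m_{3,4}=m_{5,6}=3,\quad m_{2,3}=4 .$$ A *realization* of $\mathcal G$ is a tuple $(p_v)$ of points of $\mathbb S^3$, indexed by the vertices of $\mathcal G$, whose convex hull is a convex 3-polytope combinatorially equivalent to $\mathcal G$ and such that the convex hull of a subtuple is a $k$-dimensional face exactly when its index set is the vertex set of a $k$-dimensional face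 of $\mathcal G$. The realization space $\mathcal{RS}(\mathcal G)$ is the space of realizations modulo $\mathrm{SL}_\pm(4,\mathbb R)$, with the quotient topology. A *Coxeter polytope realizing* $\mathcal G$ is a convex 3-polytope $P\subset\mathbb S^3$ combinatorially equivalent to $\mathcal G$, with facets $P_i$ corresponding to $\mathcal G_i$, together with linear reflections $r_1,\dots,r_6\in\mathrm{SL}_\pm(4,\mathbb R)$, $r_j$ being a reflection in the hyperplane supporting $P_j$, such that $r_ir_j$ has order $m_{i,j}$ whenever $\mathcal G_i,\mathcal G_j$ are adjacent, and $\mathrm{Int}(P)\cap\gamma\,\mathrm{Int}(P)=\varnothing$ for every $\gamma\neq1$ in the group generated by $r_1,\dots,r_6$. The deformation space $\mathcal C(\mathcal G)$ is the set of Coxeter polytopes realizing $\mathcal G$ modulo $\mathrm{SL}_\pm(4,\mathbb R)$. Write $r_j=\mathrm{Id}-\alpha_j\otimes v_j$ with $\alpha_j(v_j)=2$ and $\alpha_j\ge0$ on $P$; the map $\Phi:[(P,r_1,\dots,r_6)]\mapsto[(\alpha_1,\dots,\alpha_6,v_1,\dots,v_6)]$ to the orbit space $((V^*)^6\times V^6)/(\mathrm{SL}_\pm(4,\mathbb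 R)\times\mathbb R_+^6)$, where $(A,c)$ acts by $(\alpha_j,v_j)\mapsto(c_j^{-1}\alpha_j\circ A^{-1},c_jAv_j)$, induces the topology of $\mathcal C(\mathcal G)$. Let $\mathcal C(\mathcal G)\to\mathcal{RS}(\mathcal G)$ be the forgetful map $[(P,r_1,\dots,r_6)]\mapsto[P]$. Then: 1. The forgetful map is not surjective. 2. The forgetful map is not a fiber bundle over its image. 3. For $s\in(1,\infty)$ let $\gamma(s)=(e_1^*,\ e_2^*,\ e_3^*,\ e_4^*,\ e_1^*+e_2^*+e_3^*-e_4^*,\ s\,e_1^*+2e_2^*+\tfrac12e_3^*-e_4^*)$. The inequalities $\gamma(s)_i\ge0$ define the polytope of a realization of $\mathcal G$ whose $i$-th facet is supported by $\gamma(s)_i$, and this realization depends continuously on $s$; so $\gamma$ gives a continuous path in $\mathcal{RS}(\mathcal G)$. Let $F_s\subset\mathcal C(\mathcal G)$ be the fiber of the forgetful map over $[\gamma(s)]$, and let $$I_1(s)=\Bigl(\tfrac{2-4s}{3},\ \tfrac{1-9s}{14}-\tfrac{1}{14}\sqrt{1-11s+25s^2}\Bigr),\qquad I_2(s)=\Bigl(\tfrac{11-25s}{33}+\tfrac1{33}\sqrt{22-121s+163s^2},\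 -\tfrac s4\Bigr).$$ - If $1<s\le\frac{193+3\sqrt{697}}{176}$, then $F_s=\varnothing$. - If $\frac{193+3\sqrt{697}}{176}<s\le\frac{4(5+\sqrt6)}{19}$, then $F_s$ has exactly one connected component; it is homeomorphic to $I_1(s)$. - If $\frac{4(5+\sqrt6)}{19}<s\le2$, then $F_s$ has exactly two connected components; it is homeomorphic to $I_1(s)\cup I_2(s)$. In the last two cases the homeomorphism can be chosen so that the point with parameter $t$ has an image under $\Phi$ of the form $[(\gamma(s),w)]$ with $\gamma(s)_2(w_1)=t$. -/

import Mathlib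

open Set Topology

namespace CoxeterDeformation

/-! ### The projective sphere and the projective group -/

/-- The vector space `V = ℝ⁴`. -/
abbrev V : Type := Fin 4 → ℝ

/-- The dual space `V*`. -/
abbrev VDual : Type := V →L[ℝ] ℝ

/-- Nonzero vectors are equivalent when they differ by a positive factor. -/
def raySetoid : Setoid {v : V // v ≠ 0} where
  r v w := ∃ t : ℝ, 0 < t ∧ (w : V) = t • (v : V)
  iseqv :=
    { refl := fun v => ⟨1, one_pos, (one_smul ℝ (v : V)).symm⟩
      symm := by
        rintro v w ⟨t, ht, h⟩
        exact ⟨t⁻¹, inv_pos.2 ht, by rw [h, smul_smul, inv_mul_cancel₀ ht.ne', one_smul]⟩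
      trans := by
        rintro u v w ⟨t, ht, h⟩ ⟨t', ht', h'⟩
        exact ⟨t' * t, mul_pos ht' ht, by rw [h', h, smul_smul]⟩ }

/-- The projective sphere `𝕊³ = (V ∖ {0}) / ℝ₊`, with the quotient topology. -/
abbrev PSphere : Type := Quotient raySetoid

/-- The point `[v]` of the projective sphere. -/
def ray (v : V) (hv : v ≠ 0) : PSphere := Quotient.mk raySetoid ⟨v, hv⟩

/-- `𝕊(A)`: the image of `A ∖ {0}` in the projective sphere. -/
def proj (A : Set V) : Set PSphere := {x | ∃ v ∈ A, ∃ hv : v ≠ 0, x = ray v hv}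

/-- The set of all nonzero vectors lifting a point of `C`. -/
def lift (C : Set PSphere) : Set V := {v | ∃ hv : v ≠ 0, ray v hv ∈ C}

/-- The group `SL±(4, ℝ)` of linear automorphisms of `V` of determinant `±1`. -/
def SLpm : Subgroup (V ≃L[ℝ] V) where
  carrier := {A | |(A : V →L[ℝ] V).det| = 1}
  one_mem' := by
    change |LinearMap.det (LinearMap.id : V →ₗ[ℝ] V)| = 1
    simp
  mul_mem' := by
    intro A B hA hB
    change |LinearMap.det (((A : V →L[ℝ] V) : V →ₗ[ℝ] V) ∘ₗ ((B : V →L[ℝ] V) : V →ₗ[ℝ] V))| = 1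
    rw [LinearMap.det_comp, abs_mul]
    change |(A : V →L[ℝ] V).det| * |(B : V →L[ℝ] V).det| = 1
    rw [show |(A : V →L[ℝ] V).det| = 1 from hA, show |(B : V →L[ℝ] V).det| = 1 from hB, one_mul]
  inv_mem' := by
    intro A hA
    change |((A.symm : V ≃L[ℝ] V) : V →L[ℝ] V).det| = 1
    rw [ContinuousLinearEquiv.det_coe_symm, abs_inv,
      show |(A : V →L[ℝ] V).det| = 1 from hA, inv_one]

/-- The projective automorphism of the sphere induced by a linear automorphism. -/
def act (A : V ≃L[ℝ] V) : PSphere → PSphere :=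
  Quotient.map (fun v => ⟨A v.1, fun h => v.2 (A.map_eq_zero_iff.1 h)⟩) (by
    rintro v w ⟨t, ht, h⟩
    exact ⟨t, ht, by simp [h]⟩)

/-! ### Convex polytopes in the projective sphere -/

/-- The affine chart `{[v] | φ(v) > 0}`. -/
def affineChart (φ : VDual) : Set PSphere := proj {v | 0 < φ v}

/-- `C` lies in an affine chart and is convex there; the latter means that the cone of all lifts
of points of `C` is convex. -/
def IsConvexSet (C : Set PSphere) : Prop :=
  ∃ φ : VDual, φ ≠ 0 ∧ C ⊆ affineChart φ ∧ Convex ℝ (lift C)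

/-- `C` is convex and its closure is a convex bounded subset of an affine chart. (A closed subset of
the sphere that lies in an affine chart is compact, hence bounded in that chart.) -/
def IsProperlyConvex (C : Set PSphere) : Prop :=
  IsConvexSet C ∧ IsConvexSet (closure C)

/-- The convex hull in the sphere (of a set contained in an affine chart). -/
def conv (A : Set PSphere) : Set PSphere := proj (convexHull ℝ (lift A))

/-- Convex 3-polytopes: properly convex sets with nonempty interior that are cut out by finitely
many linear inequalities. -/
def IsConvexPolytope (P : Set PSphere) : Prop :=
  IsProperlyConvex P ∧ (interior P).Nonempty ∧
    ∃ (k : ℕ) (α : Fin k → VDual), (∀ i, α i ≠ 0) ∧ P = proj {v | ∀ i, 0 ≤ α i v}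

/-- `α ≥ 0` on `P`, and the hyperplane `𝕊(ker α)` meets `P` exactly in `F`. -/
def Supports (α : VDual) (P F : Set PSphere) : Prop :=
  (∀ v ∈ lift P, 0 ≤ α v) ∧ F = P ∩ proj {v | α v = 0}

/-- (Proper, nonempty) faces of `P`. -/
def IsFace (P F : Set PSphere) : Prop :=
  F.Nonempty ∧ F ≠ P ∧ ∃ α : VDual, Supports α P F

/-- The face lattice of `P`, ordered by inclusion. -/
abbrev FaceLattice (P : Set PSphere) : Type := {F : Set PSphere // IsFace P F}

/-- `F` is a `k`-dimensional face of `P`. -/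
def IsFaceOfDim (P F : Set PSphere) (k : ℕ) : Prop :=
  IsFace P F ∧ Module.finrank ℝ (Submodule.span ℝ (lift F)) = k + 1

/-! ### Labeled combinatorial polytopes -/

/-- The combinatorial data of a labeled 3-polytope with `n` vertices and `f` facets: the vertex set
of every facet, and the integer assigned to the edge between the facets `i` and `j` (only the values
at adjacent pairs are used). -/
structure LabeledPolytope (n f : ℕ) where
  facet : Fin f → Finset (Fin n)
  label : Fin f → Fin f → ℕ

namespace LabeledPolytope

variable {n f : ℕ}

/-- `F` is the vertex set of a (proper, nonempty) face: these are the nonempty intersections of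
facets. -/
def IsFace (G : LabeledPolytope n f) (F : Finset (Fin n)) : Prop :=
  F.Nonempty ∧ ∃ I : Finset (Fin f), I.Nonempty ∧ ∀ v, v ∈ F ↔ ∀ i ∈ I, v ∈ G.facet i

/-- The face lattice, ordered by inclusion. -/
abbrev FaceLattice (G : LabeledPolytope n f) : Type := {F : Finset (Fin n) // G.IsFace F}

/-- `F` is the vertex set of a `k`-dimensional face. A proper face of a 3-polytope is a vertex,
an edge or a facet according to whether it has one, two, or at least three vertices. -/
def IsFaceOfDim (G : LabeledPolytope n f) (F : Finset (Fin n)) (k : ℕ) : Prop :=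
  G.IsFace F ∧ min (F.card - 1) 2 = k

/-- Two facets are adjacent when they share an edge. -/
def Adjacent (G : LabeledPolytope n f) (i j : Fin f) : Prop :=
  i ≠ j ∧ G.IsFaceOfDim (G.facet i ∩ G.facet j) 1

end LabeledPolytope

variable {n f : ℕ}

/-! ### The realization space -/

/-- The tuple `p` of points is a realization of `G`: its convex hull is a convex 3-polytope
combinatorially equivalent to `G`, and the convex hull of a subtuple is a `k`-dimensional face
exactly when the subtuple is indexed by the vertices of a `k`-dimensional face of `G`. -/
def IsRealization (G : LabeledPolytope n f) (p : Fin n → PSphere) : Prop :=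
  IsConvexPolytope (conv (range p)) ∧
    Nonempty (G.FaceLattice ≃o FaceLattice (conv (range p))) ∧
      ∀ (F : Finset (Fin n)) (k : ℕ),
        IsFaceOfDim (conv (range p)) (conv (p '' (F : Set (Fin n)))) k ↔ G.IsFaceOfDim F k

/-- The pre-realization space of `G`, a subspace of `(𝕊³)ⁿ`. -/
abbrev PreRealization (G : LabeledPolytope n f) : Type :=
  {p : Fin n → PSphere // IsRealization G p}

/-- Realizations in the same orbit of `SL±(4, ℝ)`. -/
def realizationSetoid (G : LabeledPolytope n f) : Setoid (PreRealization G) where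
  r p q := ∃ g : SLpm, ∀ v, q.1 v = act g.1 (p.1 v)
  iseqv :=
    { refl := fun p => ⟨1, fun v => by
        refine Quotient.inductionOn (p.1 v) fun x => ?_
        rfl⟩
      symm := by
        rintro p q ⟨g, h⟩
        refine ⟨g⁻¹, fun v => ?_⟩
        rw [h]
        refine Quotient.inductionOn (p.1 v) fun x => ?_
        change Quotient.mk _ x = Quotient.mk _ _
        congr 1
        exact Subtype.ext (g.1.symm_apply_apply x.1).symm
      trans := by
        rintro p q s ⟨g, h⟩ ⟨g', h'⟩
        refine ⟨g' * g, fun v => ?_⟩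
        rw [h', h]
        refine Quotient.inductionOn (p.1 v) fun x => ?_
        rfl }

/-- The realization space `RS(G)`, with the quotient topology. -/
abbrev RealizationSpace (G : LabeledPolytope n f) : Type := Quotient (realizationSetoid G)

/-- The polytope of a realization. -/
def PreRealization.polytope {G : LabeledPolytope n f} (p : PreRealization G) : Set PSphere :=
  conv (range p.1)

/-- The `i`-th facet of the polytope of a realization. -/
def PreRealization.facet {G : LabeledPolytope n f} (p : PreRealization G) (i : Fin f) :
    Set PSphere :=
  conv (p.1 '' (G.facet i : Set (Fin n)))

/-- The polytope of `p` is cut out by the inequalities `α i ≥ 0`, and `α i` supports its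
`i`-th facet. -/
def PreRealization.DefinedBy {G : LabeledPolytope n f} (p : PreRealization G)
    (α : Fin f → VDual) : Prop :=
  p.polytope = proj {v | ∀ i, 0 ≤ α i v} ∧ ∀ i, Supports (α i) p.polytope (p.facet i)

/-! ### The deformation space -/

/-- A Coxeter 3-polytope realizing `G`: a convex polytope `P`, whose faces are identified with those
of `G` through its vertices (the field `toPre`), together with linear reflections `refl j` in the
hyperplanes supporting its facets, such that `refl i * refl j` has the order prescribed by the label
whenever the facets `i`, `j` are adjacent, and such that the translates of the interior of `P` under
the nontrivial elements of the group generated by the reflections are disjoint from the interior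
of `P`. -/
structure CoxeterPolytope (G : LabeledPolytope n f) where
  toPre : PreRealization G
  refl : Fin f → SLpm
  refl_eq : ∀ j, ∃ (α : VDual) (v : V), α v = 2 ∧ (∀ x, (refl j).1 x = x - α x • v) ∧
    Supports α toPre.polytope (toPre.facet j)
  order_eq : ∀ i j, G.Adjacent i j → orderOf (refl i * refl j) = G.label i j
  tessellate : ∀ γ ∈ Subgroup.closure (range refl), γ ≠ 1 →
    Disjoint (interior toPre.polytope) (act γ.1 '' interior toPre.polytope)

/-- Coxeter polytopes in the same orbit of `SL±(4, ℝ)`. -/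
def coxeterSetoid (G : LabeledPolytope n f) : Setoid (CoxeterPolytope G) where
  r X Y := ∃ g : SLpm, (∀ v, Y.toPre.1 v = act g.1 (X.toPre.1 v)) ∧
    ∀ j, Y.refl j = g * X.refl j * g⁻¹
  iseqv :=
    { refl := fun X => ⟨1, fun v => by
        refine Quotient.inductionOn (X.toPre.1 v) fun x => ?_
        rfl, fun j => by simp⟩
      symm := by
        rintro X Y ⟨g, h, h2⟩
        refine ⟨g⁻¹, fun v => ?_, fun j => by rw [h2]; group⟩
        rw [h]
        refine Quotient.inductionOn (X.toPre.1 v) fun x => ?_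
        change Quotient.mk _ x = Quotient.mk _ _
        congr 1
        exact Subtype.ext (g.1.symm_apply_apply x.1).symm
      trans := by
        rintro X Y Z ⟨g, h, h2⟩ ⟨g', h', h2'⟩
        refine ⟨g' * g, fun v => ?_, fun j => by rw [h2', h2]; group⟩
        rw [h', h]
        refine Quotient.inductionOn (X.toPre.1 v) fun x => ?_
        rfl }

/-- The deformation space `C(G)` of Coxeter polytopes realizing `G` (topologized below). -/
def DeformationSpace (G : LabeledPolytope n f) : Type := Quotient (coxeterSetoid G)

/-- The forgetful map `C(G) → RS(G)`, `[(P, r₁, …, r_f)] ↦ [P]`. -/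
def forget (G : LabeledPolytope n f) : DeformationSpace G → RealizationSpace G :=
  Quotient.map CoxeterPolytope.toPre (by rintro X Y ⟨g, h, -⟩; exact ⟨g, h⟩)

/-- The orbit relation of `SL±(4, ℝ) × ℝ₊^f` on `(V*)^f × V^f`, for the action
`(A, c) · (α, v) = (c⁻¹ α ∘ A⁻¹, c A v)`. -/
def pairSetoid (f : ℕ) : Setoid ((Fin f → VDual) × (Fin f → V)) where
  r a b := ∃ (A : SLpm) (c : Fin f → ℝ), (∀ j, 0 < c j) ∧ ∀ j,
    b.1 j = (c j)⁻¹ • (a.1 j).comp ((A⁻¹).1 : V →L[ℝ] V) ∧ b.2 j = c j • A.1 (a.2 j)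
  iseqv :=
    { refl := fun a => ⟨1, fun _ => 1, fun _ => one_pos, fun j => ⟨by
        ext x
        rw [inv_one, one_smul, inv_one]
        rfl, (one_smul ℝ (a.2 j)).symm⟩⟩
      symm := by
        rintro a b ⟨A, c, hc, h⟩
        refine ⟨A⁻¹, fun j => (c j)⁻¹, fun j => inv_pos.2 (hc j), fun j => ⟨?_, ?_⟩⟩
        · rw [(h j).1]
          ext x
          change a.1 j x = (c j)⁻¹⁻¹ * ((c j)⁻¹ * a.1 j (A.1.symm (A.1 x)))
          rw [A.1.symm_apply_apply, inv_inv, mul_inv_cancel_left₀ (hc j).ne']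
        · rw [(h j).2]
          change a.2 j = (c j)⁻¹ • A.1.symm (c j • A.1 (a.2 j))
          rw [map_smul, A.1.symm_apply_apply, smul_smul, inv_mul_cancel₀ (hc j).ne', one_smul]
      trans := by
        rintro a b d ⟨A, c, hc, h⟩ ⟨A', c', hc', h'⟩
        refine ⟨A' * A, fun j => c' j * c j, fun j => mul_pos (hc' j) (hc j), fun j => ⟨?_, ?_⟩⟩
        · rw [(h' j).1, (h j).1]
          ext x
          change (c' j)⁻¹ * ((c j)⁻¹ * a.1 j (A.1.symm (A'.1.symm x))) =
            (c' j * c j)⁻¹ * a.1 j ((A' * A).1.symm x)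
          rw [mul_inv, mul_assoc]
          rfl
        · rw [(h' j).2, (h j).2]
          change c' j • A'.1 (c j • A.1 (a.2 j)) = (c' j * c j) • A'.1 (A.1 (a.2 j))
          rw [map_smul, smul_smul] }

/-- The orbit space `((V*)^f × V^f) / (SL±(4, ℝ) × ℝ₊^f)`, with the quotient topology. -/
abbrev PairSpace (f : ℕ) : Type := Quotient (pairSetoid f)

/-- A functional `α` with `refl j = Id - α ⊗ v`, `α v = 2`, and `α ≥ 0` on the polytope. -/
noncomputable def CoxeterPolytope.functional {G : LabeledPolytope n f} (X : CoxeterPolytope G)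
    (j : Fin f) : VDual :=
  (X.refl_eq j).choose

/-- The vector `v` with `refl j = Id - α ⊗ v` for the chosen functional `α`. -/
noncomputable def CoxeterPolytope.vector {G : LabeledPolytope n f} (X : CoxeterPolytope G)
    (j : Fin f) : V :=
  (X.refl_eq j).choose_spec.choose

theorem CoxeterPolytope.spec {G : LabeledPolytope n f} (X : CoxeterPolytope G) (j : Fin f) :
    X.functional j (X.vector j) = 2 ∧
    (∀ x, (X.refl j).1 x = x - X.functional j x • X.vector j) ∧
    Supports (X.functional j) X.toPre.polytope (X.toPre.facet j) :=
  (X.refl_eq j).choose_spec.choose_spec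

theorem mem_lift_of_smul {C : Set PSphere} {v : V} {t : ℝ} (ht : 0 < t) (hv : v ∈ lift C) :
    t • v ∈ lift C := by
  obtain ⟨h0, h⟩ := hv
  refine ⟨smul_ne_zero ht.ne' h0, ?_⟩
  have : ray v h0 = ray (t • v) (smul_ne_zero ht.ne' h0) := Quotient.sound ⟨t, ht, rfl⟩
  rwa [← this]

theorem subset_lift_conv (A : Set PSphere) : lift A ⊆ lift (conv A) := fun v hv =>
  ⟨hv.1, v, subset_convexHull ℝ _ hv, hv.1, rfl⟩

/-- A functional vanishing on all vertices of a realization is zero. -/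
theorem exists_vertex_ne_zero {G : LabeledPolytope n f} (p : PreRealization G) {α : VDual}
    (hα : α ≠ 0) : ∃ v ∈ lift (range p.1), α v ≠ 0 := by
  by_contra! hcon
  apply hα
  have h1 : ∀ v ∈ lift (conv (range p.1)), α v = 0 := by
    rintro v ⟨hv, w, hw, hw0, hvw⟩
    have hw' : α w = 0 :=
      convexHull_min (t := {x | α x = 0}) hcon
        (convex_hyperplane (α : V →ₗ[ℝ] ℝ).isLinear 0) hw
    obtain ⟨t, ht, h⟩ := Quotient.exact hvw
    have h' : w = t • v := h
    rw [h', map_smul, smul_eq_mul] at hw'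
    exact (mul_eq_zero.1 hw').resolve_left ht.ne'
  obtain ⟨x, hx⟩ := p.2.1.2.1
  obtain ⟨⟨v, hv⟩, rfl⟩ := Quotient.exists_rep x
  have hopen : IsOpen {y : V | y ≠ 0} := isOpen_ne
  have hU : IsOpen ((fun y : {y : V // y ≠ 0} => (Quotient.mk raySetoid y)) ⁻¹'
      interior (conv (range p.1))) :=
    isOpen_interior.preimage continuous_quot_mk
  have hU' := hopen.isOpenMap_subtype_val _ hU
  have hnhds := hU'.mem_nhds ⟨⟨v, hv⟩, hx, rfl⟩
  have hz : (α : V → ℝ) =ᶠ[𝓝 v] fun _ => 0 := by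
    filter_upwards [hnhds] with y hy
    obtain ⟨⟨y', hy'⟩, hmem, rfl⟩ := hy
    exact h1 _ ⟨hy', interior_subset hmem⟩
  have := hz.fderiv_eq (𝕜 := ℝ)
  rw [α.fderiv] at this
  rw [this]
  exact fderiv_const_apply 0

/-- The map `Φ : C(G) → ((V*)^f × V^f) / (SL±(4, ℝ) × ℝ₊^f)`, `[(P, r)] ↦ [(α, v)]`, where
`r_j = Id - α_j ⊗ v_j`, `α_j(v_j) = 2` and `α_j ≥ 0` on `P`. -/
noncomputable def orbitMap (G : LabeledPolytope n f) : DeformationSpace G → PairSpace f :=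
  Quotient.lift (fun X => Quotient.mk (pairSetoid f) (X.functional, X.vector)) (by
    rintro X Y ⟨g, hv, hr⟩
    refine Quotient.sound ?_
    have key : ∀ j, ∃ c : ℝ, 0 < c ∧
        Y.functional j = c⁻¹ • (X.functional j).comp ((g⁻¹).1 : V →L[ℝ] V) ∧
        Y.vector j = c • g.1 (X.vector j) := by
      intro j
      obtain ⟨hX1, hX2, hX3⟩ := X.spec j
      obtain ⟨hY1, hY2, hY3⟩ := Y.spec j
      have hrel : ∀ x, Y.functional j x • Y.vector j =
          X.functional j (g.1.symm x) • g.1 (X.vector j) := by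
        intro x
        have h1 : (Y.refl j).1 x = g.1 ((X.refl j).1 (g.1.symm x)) := by rw [hr j]; rfl
        rw [hY2, hX2, map_sub, map_smul, g.1.apply_symm_apply] at h1
        exact sub_right_injective h1
      have hXv : g.1 (X.vector j) ≠ 0 := by
        intro h0
        rw [g.1.map_eq_zero_iff.1 h0, map_zero] at hX1
        norm_num at hX1
      set c : ℝ := X.functional j (g.1.symm (Y.vector j)) / 2 with hc
      have hvec : Y.vector j = c • g.1 (X.vector j) := by
        have h2 := hrel (Y.vector j)
        rw [hY1] at h2
        rw [hc, div_eq_inv_mul, mul_smul, ← h2, smul_smul]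
        norm_num
      have hfun : ∀ x, Y.functional j x * c = X.functional j (g.1.symm x) := by
        intro x
        have h2 := hrel x
        rw [hvec, smul_smul] at h2
        exact smul_left_injective ℝ hXv h2
      have hc0 : c ≠ 0 := by
        intro h0
        rw [h0, zero_smul] at hvec
        rw [hvec, map_zero] at hY1
        norm_num at hY1
      have hYne : Y.functional j ≠ 0 := by
        intro h0
        rw [h0] at hY1
        norm_num at hY1
      obtain ⟨y, hy, hy0⟩ := exists_vertex_ne_zero Y.toPre hYne
      have hypos : 0 < Y.functional j y :=
        lt_of_le_of_ne (hY3.1 y (subset_lift_conv _ hy)) (Ne.symm hy0)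
      have hxmem : g.1.symm y ∈ lift (range X.toPre.1) := by
        obtain ⟨hyne, u, hu⟩ := hy
        have hne : g.1.symm y ≠ 0 := fun h => hyne (g.1.symm.map_eq_zero_iff.1 h)
        rw [hv u] at hu
        obtain ⟨⟨z, hz⟩, hzu⟩ := Quotient.exists_rep (X.toPre.1 u)
        refine ⟨hne, u, ?_⟩
        rw [← hzu] at hu ⊢
        obtain ⟨t, ht, h⟩ := Quotient.exact hu
        refine Quotient.sound ⟨t, ht, ?_⟩
        have h' : y = t • g.1 z := h
        change g.1.symm y = t • z
        rw [h', map_smul, g.1.symm_apply_apply]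
      have hx : 0 ≤ X.functional j (g.1.symm y) := hX3.1 _ (subset_lift_conv _ hxmem)
      have hcpos : 0 < c := by
        rw [← hfun y] at hx
        exact lt_of_le_of_ne (nonneg_of_mul_nonneg_right hx hypos) (Ne.symm hc0)
      refine ⟨c, hcpos, ?_, hvec⟩
      ext x
      change Y.functional j x = c⁻¹ * X.functional j (g.1.symm x)
      rw [← hfun x, mul_comm, mul_assoc, mul_inv_cancel₀ hc0, mul_one]
    choose c hc h using key
    exact ⟨g, c, hc, h⟩)

/-- The topology of `C(G)` is induced by the map `Φ`. -/
noncomputable instance (G : LabeledPolytope n f) : TopologicalSpace (DeformationSpace G) :=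
  TopologicalSpace.induced (orbitMap G) inferInstance

/-! ### Fiber bundles -/

/-- The map `π` is a fiber bundle over its image: every point of the image has a neighborhood (in the
image) over which `π` is isomorphic to a product projection. (The fiber may vary with the point.) -/
def IsFiberBundleOverImage {X Y : Type} [TopologicalSpace X] [TopologicalSpace Y]
    (π : X → Y) : Prop :=
  ∀ b : range π, ∃ (F : Type) (_ : TopologicalSpace F)
    (e : Bundle.Trivialization F (rangeFactorization π)), b ∈ e.baseSet

/-! ### The example -/

/-- The labeled truncation polytope: a triangular prism with lateral facets `0, 1, 2` and bases `3`,
`4`, with the vertex common to `0, 1, 4` cut off by the facet `5`. The eight vertices lie on the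
facets `013, 123, 023, 045, 145, 015, 124, 024`, in this order. -/
def exampleG : LabeledPolytope 8 6 where
  facet := ![{0, 2, 3, 5, 7}, {0, 1, 4, 5, 6}, {1, 2, 6, 7}, {0, 1, 2}, {3, 4, 6, 7}, {3, 4, 5}]
  label :=
    ![![0, 3, 3, 2, 3, 2],
      ![3, 0, 4, 2, 3, 2],
      ![3, 4, 0, 3, 2, 0],
      ![2, 2, 3, 0, 0, 0],
      ![3, 3, 2, 0, 0, 3],
      ![2, 2, 0, 0, 3, 0]]

/-- The coordinate functional `e_i*`. -/
def coord (i : Fin 4) : VDual := ContinuousLinearMap.proj i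

/-- The path `γ(s) = (e₁*, e₂*, e₃*, e₄*, e₁* + e₂* + e₃* - e₄*, s e₁* + 2 e₂* + ½ e₃* - e₄*)`. -/
noncomputable def gammaPath (s : ℝ) : Fin 6 → VDual :=
  ![coord 0, coord 1, coord 2, coord 3, coord 0 + coord 1 + coord 2 - coord 3,
    s • coord 0 + (2 : ℝ) • coord 1 + (1 / 2 : ℝ) • coord 2 - coord 3]

/-- `(193 + 3√697) / 176`. -/
noncomputable def sEmpty : ℝ := (193 + 3 * √697) / 176

/-- `4 (5 + √6) / 19`. -/
noncomputable def sJump : ℝ := 4 * (5 + √6) / 19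

/-- The first interval of parameters. -/
noncomputable def firstInterval (s : ℝ) : Set ℝ :=
  Ioo ((2 - 4 * s) / 3) ((1 - 9 * s) / 14 - √(1 - 11 * s + 25 * s ^ 2) / 14)

/-- The second interval of parameters. -/
noncomputable def secondInterval (s : ℝ) : Set ℝ :=
  Ioo ((11 - 25 * s) / 33 + √(22 - 121 * s + 163 * s ^ 2) / 33) (-s / 4)

/-- The fiber of the forgetful map over a point of the realization space. -/
abbrev fiber (x : RealizationSpace exampleG) : Set (DeformationSpace exampleG) :=
  forget exampleG ⁻¹' {x}

/-- The fiber over `x` is parametrized by the set `I`: it is homeomorphic to `I` so that the point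
with parameter `t` is represented by a pair `(γ(s), w)` with `γ(s)₂(w₁) = t`. -/
def FiberParametrizedBy (s : ℝ) (x : RealizationSpace exampleG) (I : Set ℝ) : Prop :=
  ∃ h : fiber x ≃ₜ I, ∀ c : fiber x, ∃ w : Fin 6 → V,
    orbitMap exampleG c.1 = Quotient.mk (pairSetoid 6) (gammaPath s, w) ∧
      gammaPath s 1 (w 0) = (h c : ℝ)

end CoxeterDeformation

open CoxeterDeformation

/-! Indices start at 0 here. After a projective change, a Coxeter polytope over the class of
`gammaPath s` has facet functionals `γ j = gammaPath s j`, so it amounts to vectors `w j` with `γ j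
(w j) = 2`. Everything is read off the Cartan matrix `A i j = γ i (w j)`, in the spirit of Vinberg.

Necessity: the group generated by the two reflections at an edge fixes the edge, so near an interior
point of it the tessellation condition concerns a wedge. The order of the product then forces `A i j
* A j i = 4 cos²(π/m)`, with both entries negative, or both zero when `m = 2`
(`isCartanPair_of_adjacent`). Sufficiency: if moreover nonadjacent facets give negative entries with
product at least 4, Tits' induction on word length shows that nontrivial translates of the chamber
are disjoint from it (`eq_one_of_chamber_inter`).

The twelve edge conditions determine all `w j` from the single number `t = γ 1 (w 0)` and leave only
sign conditions (`mem_paramSet_of_isCartanPair`); the nonadjacent pairs then cost nothing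
(`isCartanPair_pathVector`). So the fiber is in bijection with `paramSet s`. The bijection is a
homeomorphism because `t` is a Möbius function of the cyclic product `A 1 0 * A 2 1 * A 0 2`, a
continuous invariant of the orbit space.

For `1 < s ≤ 2` the signs say that `(2 - 4s)/3 < t < -s/4` and that two upward parabolas in `t`,
`quad1` and `quad2`, are positive. Their roots alternate, so both are positive exactly below the
smaller root of `quad1` or above the larger root of `quad2`: these are the two intervals. The first
is nonempty when `quad1` is positive at `(2 - 4s)/3`, the second when `quad2` is positive at `-s/4`;
this gives `sEmpty` and `sJump`. The fiber over `sEmpty` is empty, so the forgetful map is not onto.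
The fiber has one component at `sJump` and two just after it, so no local trivialization exists
there. -/

namespace CoxeterDeformation

/-! ### Groups generated by reflections -/

section Tits

variable {B W X : Type*} [Group W] {M : CoxeterMatrix B} (cs : CoxeterSystem M W)
  [MulAction W X] {α : B → X → ℝ} {A : B → B → ℝ}

/-- Entries of a Cartan matrix compatible with a Coxeter matrix all of whose finite off-diagonal
entries are at most `4`. -/
def IsCartanPair (m : ℕ) (a b : ℝ) : Prop :=
  (m = 2 ∧ a = 0 ∧ b = 0) ∨ a < 0 ∧ b < 0 ∧
    (m = 3 ∧ a * b = 1 ∨ m = 4 ∧ a * b = 2 ∨ m = 0 ∧ 4 ≤ a * b)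

theorem IsCartanPair.symm {m : ℕ} {a b : ℝ} (h : IsCartanPair m a b) : IsCartanPair m b a := by
  unfold IsCartanPair at *
  rw [mul_comm b a]
  tauto

theorem eq_mul_simple {v : W} (i : B) (x : X) :
    v⁻¹ • x = cs.simple i • ((v * cs.simple i)⁻¹ • x) := by
  rw [smul_smul]
  congr 1
  simp

/-- In an infinite dihedral group the positive combinations `p α_a + q α_b` with `-A b a * q ≥ 2 *
p` reproduce themselves. Peeling `a` off `v` turns the pair `(p, q)` into `(q, -p - A b a * q)` with
`a` and `b` exchanged. The new second coefficient is at least `-A b a * q / 2`, so the product being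
at least 4 gives the same inequality again. When neither letter is a descent, both terms are
nonnegative by `IH`. -/
theorem nonneg_of_infinite_rank_two (hdiag : ∀ i, A i i = 2)
    (hact : ∀ i j x, α i (cs.simple j • x) = α i x - A i j * α j x) {x : X} {N : ℕ}
    (IH : ∀ v : W, cs.length v < N → ∀ s, ¬ cs.IsRightDescent v s → 0 ≤ α s (v⁻¹ • x)) :
    ∀ (n : ℕ) (v : W) (a b : B) (p q : ℝ), cs.length v = n → n < N → A a b < 0 → A b a < 0 →
      4 ≤ A a b * A b a → ¬ cs.IsRightDescent v b → 0 ≤ p → -A b a * q ≥ 2 * p →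
      0 ≤ p * α a (v⁻¹ • x) + q * α b (v⁻¹ • x) := by
  intro n
  induction n using Nat.strong_induction_on with
  | _ n ih =>
    intro v a b p q hn hN hab hba h4 hb hp hpq
    have hq : 0 ≤ q := by
      by_contra! hq
      nlinarith
    by_cases ha : cs.IsRightDescent v a
    · have hlen : cs.length (v * cs.simple a) < n := hn ▸ ha
      have key := ih _ hlen (v * cs.simple a) b a q (-p - A b a * q) rfl (hlen.trans hN) hba hab
        (by linarith) (cs.isRightDescent_iff_not_isRightDescent_mul.1 ha) hq (by nlinarith)
      rw [eq_mul_simple cs a, hact, hact, hdiag]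
      linarith
    · have h1 := IH v (hn ▸ hN) a ha
      have h2 := IH v (hn ▸ hN) b hb
      positivity

theorem length_mul_simple_ge (w : W) (i : B) :
    cs.length w ≤ cs.length (w * cs.simple i) + 1 := by
  rcases cs.length_mul_simple w i with h | h <;> omega

/-- Tits' lemma, by induction on length. Take a descent `t ≠ s` of `w` and peel off letters `t`,
`s`, `t`, ... as long as they are descents. What remains has neither letter as a descent and is
shorter, and `α s` has become a combination of `α s` and `α t` with nonnegative coefficients. The
braid relation prevents the peeling from going on so long that `s` would be a descent of `w`. -/
theorem nonneg_of_not_isRightDescent (hdiag : ∀ i, A i i = 2)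
    (hA : ∀ i j, i ≠ j → IsCartanPair (M i j) (A i j) (A j i))
    (hact : ∀ i j x, α i (cs.simple j • x) = α i x - A i j * α j x) {x : X}
    (hx : ∀ i, 0 < α i x) :
    ∀ (n : ℕ) (w : W), cs.length w = n → ∀ s, ¬ cs.IsRightDescent w s → 0 ≤ α s (w⁻¹ • x) := by
  intro n
  induction n using Nat.strong_induction_on with
  | _ n ih =>
    intro w hn s hs
    by_cases hw : w = 1
    · subst hw
      simpa using (hx s).le
    obtain ⟨t, ht⟩ := cs.exists_rightDescent_of_ne_one hw
    have hst : s ≠ t := fun h => hs (h ▸ ht)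
    have IH : ∀ v : W, cs.length v < n → ∀ s, ¬ cs.IsRightDescent v s → 0 ≤ α s (v⁻¹ • x) :=
      fun v hv => ih _ hv v rfl
    have hlen : cs.length (w * cs.simple t) < n := hn ▸ ht
    have ht' := cs.isRightDescent_iff_not_isRightDescent_mul.1 ht
    have hws : cs.length (w * cs.simple s) = n + 1 := hn ▸ cs.not_isRightDescent_iff.1 hs
    rw [eq_mul_simple cs t, hact]
    have hd : ∀ {v : W} {i : B}, cs.IsRightDescent v i →
        cs.length (v * cs.simple i) + 1 = cs.length v := fun h => cs.isRightDescent_iff.1 h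
    have hwt := hd ht
    rcases hA s t hst with ⟨hm, h1, h2⟩ | ⟨h1, h2, ⟨hm, h3⟩ | ⟨hm, h3⟩ | ⟨-, h3⟩⟩
    · rw [h1, zero_mul, sub_zero]
      -- For `m = 2`: otherwise `w t s = w s t` would have length `n - 2`, whereas `w s` has length
      -- `n + 1`.
      refine IH _ hlen s fun h => ?_
      have hb : w * cs.simple t * cs.simple s = w * cs.simple s * cs.simple t := by
        have := cs.wordProd_braidWord_eq s t
        simp only [CoxeterSystem.braidWord, M.symmetric t s, hm, CoxeterSystem.alternatingWord,
          cs.wordProd_concat, cs.wordProd_nil, one_mul] at this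
        simp only [mul_assoc, this]
      have := hd h
      have := length_mul_simple_ge cs (w * cs.simple s) t
      rw [hb] at *
      omega
    -- For `m = 3`: since `A s t * A t s = 1`, after peeling `t` and `s` the functional is `-A s t`
    -- times `α t`.
    · by_cases h : cs.IsRightDescent (w * cs.simple t) s
      · have hl := hd h
        rw [eq_mul_simple cs s, hact, hact, hdiag]
        have e1 := IH (w * cs.simple t * cs.simple s) (by omega) t (fun h' => by
          have hb : w * cs.simple t * cs.simple s * cs.simple t =
              w * cs.simple s * cs.simple t * cs.simple s := by
            have := cs.wordProd_braidWord_eq s t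
            simp only [CoxeterSystem.braidWord, M.symmetric t s, hm, CoxeterSystem.alternatingWord,
              cs.wordProd_concat, cs.wordProd_nil, one_mul] at this
            simp only [mul_assoc] at this ⊢
            rw [this]
          have := hd h'
          have := length_mul_simple_ge cs (w * cs.simple s) t
          have := length_mul_simple_ge cs (w * cs.simple s * cs.simple t) s
          rw [hb] at *
          omega)
        have e2 := IH (w * cs.simple t * cs.simple s) (by omega) s
          (cs.isRightDescent_iff_not_isRightDescent_mul.1 h)
        nlinarith
      · nlinarith [IH _ hlen s h, IH _ hlen t ht']
    -- For `m = 4`: since `A s t * A t s = 2`, peeling `t`, `s`, `t` brings `α s` back to itself.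
    · by_cases h : cs.IsRightDescent (w * cs.simple t) s
      · have hl := hd h
        have e2 := cs.isRightDescent_iff_not_isRightDescent_mul.1 h
        rw [eq_mul_simple cs s, hact, hact, hdiag]
        by_cases h' : cs.IsRightDescent (w * cs.simple t * cs.simple s) t
        · have hl' := hd h'
          rw [eq_mul_simple cs t, hact, hact, hdiag]
          have e3 := cs.isRightDescent_iff_not_isRightDescent_mul.1 h'
          have f1 := IH (w * cs.simple t * cs.simple s * cs.simple t) (by omega) t e3
          have f2 := IH (w * cs.simple t * cs.simple s * cs.simple t) (by omega) s (fun h'' => by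
            have hb : w * cs.simple t * cs.simple s * cs.simple t * cs.simple s =
                w * cs.simple s * cs.simple t * cs.simple s * cs.simple t := by
              have := cs.wordProd_braidWord_eq s t
              simp only [CoxeterSystem.braidWord, M.symmetric t s, hm,
                CoxeterSystem.alternatingWord, cs.wordProd_concat, cs.wordProd_nil, one_mul] at this
              simp only [mul_assoc] at this ⊢
              rw [this]
            have := hd h''
            have := length_mul_simple_ge cs (w * cs.simple s) t
            have := length_mul_simple_ge cs (w * cs.simple s * cs.simple t) s
            have := length_mul_simple_ge cs (w * cs.simple s * cs.simple t * cs.simple s) t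
            rw [hb] at *
            omega)
          generalize (w * cs.simple t * cs.simple s * cs.simple t)⁻¹ • x = y at f2 ⊢
          linear_combination f2 - (α s y - A s t * α t y) * h3
        · have f1 := IH _ (by omega) t h'
          have f2 := IH _ (by omega) s e2
          nlinarith
      · nlinarith [IH _ hlen s h, IH _ hlen t ht']
    · have := nonneg_of_infinite_rank_two cs hdiag hact IH _ _ s t 1 (-A s t) rfl hlen h1 h2 h3 ht'
        zero_le_one (by nlinarith)
      linarith

/-- Translates of the open chamber by nontrivial elements are disjoint from it. -/
theorem eq_one_of_chamber_inter (hdiag : ∀ i, A i i = 2)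
    (hA : ∀ i j, i ≠ j → IsCartanPair (M i j) (A i j) (A j i))
    (hact : ∀ i j x, α i (cs.simple j • x) = α i x - A i j * α j x) {x : X}
    (hx : ∀ i, 0 < α i x) {w : W} (hw : ∀ i, 0 < α i (w • x)) : w = 1 := by
  by_contra hne
  -- Tits' lemma is applied with base point `w • x` and the element `w * s`, which no longer has `s`
  -- as a descent: it gives `α s (s • x) ≥ 0`, but this value is `-α s x < 0`.
  obtain ⟨s, hs⟩ := cs.exists_rightDescent_of_ne_one hne
  have h := nonneg_of_not_isRightDescent cs hdiag hA hact hw _ (w * cs.simple s) rfl s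
    (cs.isRightDescent_iff_not_isRightDescent_mul.1 hs)
  have h2 : (w * cs.simple s)⁻¹ • w • x = cs.simple s • x := by
    rw [smul_smul]
    congr 1
    simp
  rw [h2, hact, hdiag] at h
  linarith [hx s]

end Tits

/-! ### Cones and the projective sphere -/

theorem ray_eq_ray_iff {v w : V} {hv : v ≠ 0} {hw : w ≠ 0} :
    ray v hv = ray w hw ↔ ∃ t : ℝ, 0 < t ∧ w = t • v :=
  ⟨fun h => Quotient.exact h, fun h => Quotient.sound h⟩

theorem exists_eq_ray (x : PSphere) : ∃ (v : V) (hv : v ≠ 0), x = ray v hv := by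
  obtain ⟨⟨v, hv⟩, rfl⟩ := Quotient.exists_rep x
  exact ⟨v, hv, rfl⟩

theorem act_ray (g : V ≃L[ℝ] V) (v : V) (hv : v ≠ 0) :
    act g (ray v hv) = ray (g v) (fun h => hv (g.map_eq_zero_iff.1 h)) := rfl

/-- A set of vectors stable under multiplication by positive scalars. -/
def IsPosCone (A : Set V) : Prop := ∀ t : ℝ, 0 < t → ∀ v ∈ A, t • v ∈ A

theorem lift_proj {A : Set V} (hA : IsPosCone A) : lift (proj A) = {v ∈ A | v ≠ 0} := by
  ext v
  constructor
  · rintro ⟨hv, w, hw, hw0, h⟩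
    obtain ⟨t, ht, rfl⟩ := ray_eq_ray_iff.1 h
    refine ⟨?_, hv⟩
    have := hA _ (inv_pos.2 ht) _ hw
    rwa [smul_smul, inv_mul_cancel₀ ht.ne', one_smul] at this
  · rintro ⟨hv, h0⟩
    exact ⟨h0, v, hv, h0, rfl⟩

theorem proj_lift (C : Set PSphere) : proj (lift C) = C := by
  ext x
  constructor
  · rintro ⟨v, ⟨hv, h⟩, hv', rfl⟩
    exact h
  · intro hx
    obtain ⟨v, hv, rfl⟩ := exists_eq_ray x
    exact ⟨v, ⟨hv, hx⟩, hv, rfl⟩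

theorem ray_mem_proj {A : Set V} (hA : IsPosCone A) {v : V} {hv : v ≠ 0} :
    ray v hv ∈ proj A ↔ v ∈ A := by
  have : ray v hv ∈ proj A ↔ v ∈ lift (proj A) := ⟨fun h => ⟨hv, h⟩, fun h => h.2⟩
  rw [this, lift_proj hA]
  exact ⟨fun h => h.1, fun h => ⟨h, hv⟩⟩

theorem lift_injective : Function.Injective lift := fun A B h => by
  rw [← proj_lift A, h, proj_lift]

theorem lift_subset_lift {A B : Set PSphere} : lift A ⊆ lift B ↔ A ⊆ B := by
  constructor
  · intro h x hx
    obtain ⟨v, hv, rfl⟩ := exists_eq_ray x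
    exact (h ⟨hv, hx⟩ : v ∈ lift B).2
  · rintro h v ⟨hv, hx⟩
    exact ⟨hv, h hx⟩

theorem lift_inter (A B : Set PSphere) : lift (A ∩ B) = lift A ∩ lift B := by
  ext v
  constructor
  · rintro ⟨hv, h1, h2⟩
    exact ⟨⟨hv, h1⟩, ⟨hv, h2⟩⟩
  · rintro ⟨⟨hv, h1⟩, ⟨_, h2⟩⟩
    exact ⟨hv, h1, h2⟩

theorem isOpen_proj {A : Set V} (hA : IsPosCone A) (hopen : IsOpen A) : IsOpen (proj A) := by
  have h : IsOpen ((Quotient.mk raySetoid) ⁻¹' proj A) := by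
    have : (Quotient.mk raySetoid) ⁻¹' proj A = Subtype.val ⁻¹' A := by
      ext ⟨v, hv⟩
      exact ray_mem_proj hA
    rw [this]
    exact hopen.preimage continuous_subtype_val
  exact h

theorem isClosed_proj {A : Set V} (hA : IsPosCone A) (hclosed : IsClosed A) :
    IsClosed (proj A) := by
  have hc : IsPosCone Aᶜ := fun t ht v hv hmem => hv (by
    have := hA _ (inv_pos.2 ht) _ hmem
    rwa [smul_smul, inv_mul_cancel₀ ht.ne', one_smul] at this)
  have : (proj A)ᶜ = proj Aᶜ := by
    ext x
    obtain ⟨v, hv, rfl⟩ := exists_eq_ray x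
    rw [mem_compl_iff, ray_mem_proj hA, ray_mem_proj hc, mem_compl_iff]
  exact ⟨this ▸ isOpen_proj hc hclosed.isOpen_compl⟩

theorem isPosCone_nonneg {ι : Type*} (α : ι → VDual) : IsPosCone {v | ∀ i, 0 ≤ α i v} :=
  fun t ht v hv i => by
    rw [map_smul]
    exact mul_nonneg ht.le (hv i)

theorem isPosCone_pos {ι : Type*} (α : ι → VDual) : IsPosCone {v | ∀ i, 0 < α i v} :=
  fun t ht v hv i => by
    rw [map_smul]
    exact mul_pos ht (hv i)

theorem isPosCone_ker (α : VDual) : IsPosCone {v | α v = 0} := fun t _ v hv => by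
  rw [mem_ofPred_eq, map_smul, show α v = 0 from hv, smul_zero]

theorem interior_proj_nonneg {ι : Type*} [Finite ι] {α : ι → VDual} (hα : ∀ i, α i ≠ 0) :
    interior (proj {v | ∀ i, 0 ≤ α i v}) = proj {v | ∀ i, 0 < α i v} := by
  apply Subset.antisymm
  · intro x hx
    obtain ⟨v, hv, rfl⟩ := exists_eq_ray x
    rw [ray_mem_proj (isPosCone_pos α)]
    intro i
    have hU : IsOpen ((fun y : {y : V // y ≠ 0} => (Quotient.mk raySetoid y)) ⁻¹'
        interior (proj {v | ∀ i, 0 ≤ α i v})) :=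
      isOpen_interior.preimage continuous_quot_mk
    have hnhds := ((isOpen_ne : IsOpen {y : V | y ≠ 0}).isOpenMap_subtype_val _ hU).mem_nhds
      ⟨⟨v, hv⟩, hx, rfl⟩
    obtain ⟨y, hy⟩ : ∃ y, α i y ≠ 0 := by
      by_contra! h
      exact hα i (ContinuousLinearMap.ext h)
    -- A direction with `α i z = (α i y)² > 0`; moving from `v` by a small multiple of `-z` stays in
    -- the interior.
    set z : V := α i y • y
    have hz : 0 < α i z := by
      rw [map_smul, smul_eq_mul, ← pow_two]
      positivity
    have hlim : Filter.Tendsto (fun e : ℝ => v - e • z) (𝓝[>] 0) (𝓝 v) := by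
      have : Continuous fun e : ℝ => v - e • z := by fun_prop
      have := (this.tendsto 0).mono_left (nhdsWithin_le_nhds (s := Ioi 0))
      simpa using this
    have hev := (hlim.eventually hnhds).and self_mem_nhdsWithin
    obtain ⟨e, ⟨⟨w, hw⟩, hw', hwe⟩, he⟩ := hev.exists
    have hmem := (ray_mem_proj (isPosCone_nonneg α)).1 (interior_subset hw') i
    rw [show w = v - e • z from hwe, map_sub, map_smul, smul_eq_mul] at hmem
    have : 0 < e * α i z := mul_pos he hz
    linarith
  · apply interior_maximal
    · rintro _ ⟨v, hv, hv0, rfl⟩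
      exact ⟨v, fun i => (hv i).le, hv0, rfl⟩
    · apply isOpen_proj (isPosCone_pos α)
      simp only [ofPred_forall]
      exact isOpen_iInter_of_finite fun i => isOpen_lt continuous_const (α i).continuous

theorem isConvexPolytope_proj {k : ℕ} {α : Fin k → VDual} {φ : VDual} (hφ0 : φ ≠ 0)
    (hφ : ∀ v, (∀ i, 0 ≤ α i v) → v ≠ 0 → 0 < φ v) {x : V} (hx0 : x ≠ 0) (hx : ∀ i, 0 < α i x) :
    IsConvexPolytope (proj {v | ∀ i, 0 ≤ α i v}) := by
  have hconv : IsConvexSet (proj {v | ∀ i, 0 ≤ α i v}) := by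
    refine ⟨φ, hφ0, ?_, ?_⟩
    · rintro _ ⟨v, hv, hv0, rfl⟩
      exact ⟨v, hφ v hv hv0, hv0, rfl⟩
    · rw [lift_proj (isPosCone_nonneg α)]
      have : {v ∈ {v | ∀ i, 0 ≤ α i v} | v ≠ 0} = (⋂ i, {v | 0 ≤ α i v}) ∩ {v | 0 < φ v} := by
        ext v
        simp only [mem_ofPred_eq, mem_inter_iff, mem_iInter]
        refine and_congr_right fun h => ⟨fun h0 => hφ v h h0, ?_⟩
        rintro h' rfl
        simp at h'
      rw [this]
      exact (convex_iInter fun i => convex_halfSpace_ge (α i : V →ₗ[ℝ] ℝ).isLinear 0).inter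
        (convex_halfSpace_gt (φ : V →ₗ[ℝ] ℝ).isLinear 0)
  have hclosed : IsClosed (proj {v | ∀ i, 0 ≤ α i v}) := by
    apply isClosed_proj (isPosCone_nonneg α)
    simp only [ofPred_forall]
    exact isClosed_iInter fun i => isClosed_le continuous_const (α i).continuous
  have hα : ∀ i, α i ≠ 0 := fun i h => by
    have := hx i
    simp [h] at this
  refine ⟨⟨hconv, by rwa [hclosed.closure_eq]⟩, ?_, k, α, hα, rfl⟩
  rw [interior_proj_nonneg hα]
  exact ⟨_, x, hx, hx0, rfl⟩

/-- The cone generated by the vectors `P v`, `v ∈ F`. -/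
def coneHull {n : ℕ} (P : Fin n → V) (F : Set (Fin n)) : Set V :=
  {x | ∃ c : Fin n → ℝ, (∀ v, 0 ≤ c v) ∧ (∀ v, v ∉ F → c v = 0) ∧ x = ∑ v, c v • P v}

theorem mem_coneHull {n : ℕ} {P : Fin n → V} {F : Set (Fin n)} {v : Fin n} (hv : v ∈ F) :
    P v ∈ coneHull P F := by
  classical
  refine ⟨Pi.single v 1, fun u => ?_, fun u hu => ?_, ?_⟩
  · by_cases h : u = v
    · subst h
      simp
    · simp [h]
  · have : u ≠ v := fun h => hu (h ▸ hv)
    simp [this]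
  · simp [Pi.single_apply, ite_smul]

theorem isPosCone_coneHull {n : ℕ} (P : Fin n → V) (F : Set (Fin n)) :
    IsPosCone (coneHull P F) := by
  rintro t ht _ ⟨c, hc, hF, rfl⟩
  refine ⟨fun v => t * c v, fun v => mul_nonneg ht.le (hc v), fun v hv => ?_, ?_⟩
  · simp [hF v hv]
  · simp [Finset.smul_sum, mul_smul]

theorem convex_coneHull {n : ℕ} (P : Fin n → V) (F : Set (Fin n)) :
    Convex ℝ (coneHull P F) := by
  rintro _ ⟨c, hc, hF, rfl⟩ _ ⟨c', hc', hF', rfl⟩ a b ha hb -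
  refine ⟨fun v => a * c v + b * c' v,
    fun v => add_nonneg (mul_nonneg ha (hc v)) (mul_nonneg hb (hc' v)), fun v hv => ?_, ?_⟩
  · simp [hF v hv, hF' v hv]
  · simp [Finset.smul_sum, mul_smul, add_smul, Finset.sum_add_distrib]

theorem lift_conv_image {n : ℕ} {P : Fin n → V} (hP : ∀ v, P v ≠ 0) (F : Set (Fin n)) :
    lift (conv ((fun v => ray (P v) (hP v)) '' F)) = {x ∈ coneHull P F | x ≠ 0} := by
  ext x
  constructor
  · rintro ⟨hx, w, hw, hw0, h⟩
    refine ⟨?_, hx⟩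
    obtain ⟨t, ht, rfl⟩ := ray_eq_ray_iff.1 h
    have : t • x ∈ coneHull P F := by
      refine convexHull_min ?_ (convex_coneHull P F) hw
      rintro y ⟨hy, u, hu, h'⟩
      obtain ⟨t', ht', rfl⟩ := ray_eq_ray_iff.1 h'
      exact isPosCone_coneHull P F _ ht' _ (mem_coneHull hu)
    have := isPosCone_coneHull P F _ (inv_pos.2 ht) _ this
    rwa [smul_smul, inv_mul_cancel₀ ht.ne', one_smul] at this
  · rintro ⟨⟨c, hc, hF, rfl⟩, hx⟩
    classical
    -- Dividing by the total weight turns a conical combination into a convex one, without changing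
    -- the ray.
    set C := ∑ v, c v with hC
    have hC0 : 0 < C := by
      refine lt_of_le_of_ne (Finset.sum_nonneg fun v _ => hc v) fun h => hx ?_
      have := (Finset.sum_eq_zero_iff_of_nonneg fun v _ => hc v).1 h.symm
      exact Finset.sum_eq_zero fun v hv => by rw [this v hv, zero_smul]
    have hmem : C⁻¹ • ∑ v, c v • P v ∈
        convexHull ℝ (lift ((fun v => ray (P v) (hP v)) '' F)) := by
      have hsum : ∀ {E : Type} [AddCommMonoid E] (g : Fin n → E), (∀ v, v ∉ F → g v = 0) →
          ∑ v with v ∈ F, g v = ∑ v, g v := fun g hg =>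
        Finset.sum_subset (Finset.filter_subset _ _) fun v _ hv => hg v (by simpa using hv)
      have := Convex.sum_mem (t := Finset.univ.filter (· ∈ F)) (w := fun v => C⁻¹ * c v) (z := P)
        (convex_convexHull ℝ (lift ((fun v => ray (P v) (hP v)) '' F)))
        (fun v _ => mul_nonneg (inv_pos.2 hC0).le (hc v))
        (by
          rw [← Finset.mul_sum, hsum c hF, ← hC, inv_mul_cancel₀ hC0.ne'])
        (fun v hv => subset_convexHull ℝ _ ⟨hP v, v, (Finset.mem_filter.1 hv).2, rfl⟩)
      simp only [mul_smul] at this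
      rwa [← Finset.smul_sum, hsum _ fun v hv => by rw [hF v hv, zero_smul]] at this
    refine ⟨hx, C⁻¹ • ∑ v, c v • P v, hmem, smul_ne_zero (inv_pos.2 hC0).ne' hx, ?_⟩
    exact ray_eq_ray_iff.2 ⟨_, inv_pos.2 hC0, rfl⟩

theorem lift_conv_range {n : ℕ} {P : Fin n → V} (hP : ∀ v, P v ≠ 0) :
    lift (conv (range fun v => ray (P v) (hP v))) = {x ∈ coneHull P univ | x ≠ 0} := by
  rw [← image_univ]
  exact lift_conv_image hP univ

theorem lift_act_image (g : V ≃L[ℝ] V) (A : Set PSphere) : lift (act g '' A) = g '' lift A := by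
  ext v
  constructor
  · rintro ⟨hv, x, hx, h⟩
    obtain ⟨w, hw, rfl⟩ := exists_eq_ray x
    obtain ⟨t, ht, rfl⟩ := ray_eq_ray_iff.1 h
    exact ⟨t • w, mem_lift_of_smul ht ⟨hw, hx⟩, map_smul g t w⟩
  · rintro ⟨w, ⟨hw, hx⟩, rfl⟩
    exact ⟨fun h => hw (g.map_eq_zero_iff.1 h), _, hx, rfl⟩

theorem conv_act_image (g : V ≃L[ℝ] V) (A : Set PSphere) :
    conv (act g '' A) = act g '' conv A := by
  unfold conv
  rw [lift_act_image]
  have := (g : V →ₗ[ℝ] V).image_convexHull (lift A)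
  change g '' _ = convexHull ℝ (g '' _) at this
  rw [← this]
  ext x
  constructor
  · rintro ⟨_, ⟨v, hv, rfl⟩, hv0, rfl⟩
    exact ⟨_, ⟨v, hv, fun h => hv0 (by rw [h, map_zero]), rfl⟩, rfl⟩
  · rintro ⟨_, ⟨v, hv, hv0, rfl⟩, rfl⟩
    exact ⟨g v, ⟨v, hv, rfl⟩, _, rfl⟩

/-! ### Recognizing realizations -/

/-- Vertices `P v` and inequalities `γ i ≥ 0` describing the same cone, with the incidences of the
combinatorial polytope `G`. -/
structure ConeRealization {n f : ℕ} (G : LabeledPolytope n f) (P : Fin n → V)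
    (γ : Fin f → VDual) : Prop where
  nonneg : ∀ i v, 0 ≤ γ i (P v)
  eq_zero_iff : ∀ i v, γ i (P v) = 0 ↔ v ∈ G.facet i
  mem_cone : ∀ x, (∀ i, 0 ≤ γ i x) → x ∈ coneHull P univ
  dual : ∀ α : VDual, (∀ v, 0 ≤ α (P v)) →
    ∃ c : Fin f → ℝ, (∀ i, 0 ≤ c i) ∧ ∀ x, α x = ∑ i, c i * γ i x
  ne_zero : ∀ v, P v ≠ 0
  separate : ∀ v u, v ≠ u → ∃ i, v ∈ G.facet i ∧ u ∉ G.facet i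
  facet_ne : ∀ i, ∃ v, v ∉ G.facet i
  facet_triple : ∀ i, ∃ u v w j, u ≠ v ∧ u ∈ G.facet i ∧ v ∈ G.facet i ∧ w ∈ G.facet i ∧
    u ∈ G.facet j ∧ v ∈ G.facet j ∧ w ∉ G.facet j
  card_inter : ∀ i j, i ≠ j → (G.facet i ∩ G.facet j).card ≤ 2
  facet_diff : ∀ i j, i ≠ j → ∃ v, v ∈ G.facet i ∧ v ∉ G.facet j
  pos : ∃ φ : VDual, φ ≠ 0 ∧ ∀ v, (∀ i, 0 ≤ γ i v) → v ≠ 0 → 0 < φ v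
  vertex_pos : 0 < n

namespace ConeRealization

variable {n f : ℕ} {G : LabeledPolytope n f} {P : Fin n → V} {γ : Fin f → VDual}
  (h : ConeRealization G P γ)
include h

theorem coneHull_eq : coneHull P univ = {x | ∀ i, 0 ≤ γ i x} := by
  ext x
  refine ⟨?_, h.mem_cone x⟩
  rintro ⟨c, hc, -, rfl⟩ i
  rw [map_sum]
  exact Finset.sum_nonneg fun v _ => by
    rw [map_smul]
    exact mul_nonneg (hc v) (h.nonneg i v)

theorem lift_polytope : lift (conv (range fun v => ray (P v) (h.ne_zero v))) =
    {x ∈ {x | ∀ i, 0 ≤ γ i x} | x ≠ 0} := by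
  rw [lift_conv_range, h.coneHull_eq]

theorem polytope_eq : conv (range fun v => ray (P v) (h.ne_zero v)) =
    proj {x | ∀ i, 0 ≤ γ i x} := by
  apply lift_injective
  rw [h.lift_polytope, lift_proj (isPosCone_nonneg γ)]

/-- The face on which a functional of the dual cone vanishes. -/
theorem inter_ker {α : VDual} (hα : ∀ v, 0 ≤ α (P v)) {F : Set (Fin n)}
    (hF : ∀ v, v ∈ F ↔ α (P v) = 0) :
    conv ((fun v => ray (P v) (h.ne_zero v)) '' F) =
      conv (range fun v => ray (P v) (h.ne_zero v)) ∩ proj {v | α v = 0} := by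
  apply lift_injective
  rw [lift_inter, lift_conv_image, lift_conv_range, lift_proj (isPosCone_ker α)]
  ext x
  constructor
  · rintro ⟨⟨c, hc, hcF, rfl⟩, hx⟩
    refine ⟨⟨⟨c, hc, fun v hv => absurd (mem_univ v) hv, rfl⟩, hx⟩, ?_, hx⟩
    change α _ = 0
    rw [map_sum]
    refine Finset.sum_eq_zero fun v _ => ?_
    by_cases hv : v ∈ F
    · rw [map_smul, (hF v).1 hv, smul_zero]
    · rw [hcF v hv, zero_smul, map_zero]
  · rintro ⟨⟨⟨c, hc, -, rfl⟩, hx⟩, hα0, -⟩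
    refine ⟨⟨c, hc, fun v hv => ?_, rfl⟩, hx⟩
    change α _ = 0 at hα0
    rw [map_sum, Finset.sum_eq_zero_iff_of_nonneg fun v _ => by
      rw [map_smul]
      exact mul_nonneg (hc v) (hα v)] at hα0
    have := hα0 v (Finset.mem_univ v)
    rw [map_smul, smul_eq_mul, mul_eq_zero] at this
    exact this.resolve_right fun h' => hv ((hF v).2 h')

theorem nonneg_on_lift {α : VDual} (hα : ∀ v, 0 ≤ α (P v)) :
    ∀ v ∈ lift (conv (range fun v => ray (P v) (h.ne_zero v))), 0 ≤ α v := by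
  rw [lift_conv_range]
  rintro _ ⟨⟨c, hc, -, rfl⟩, -⟩
  rw [map_sum]
  exact Finset.sum_nonneg fun v _ => by
    rw [map_smul]
    exact mul_nonneg (hc v) (hα v)

theorem mem_lift_conv {F : Set (Fin n)} {v : Fin n} (hv : v ∈ F) :
    P v ∈ lift (conv ((fun v => ray (P v) (h.ne_zero v)) '' F)) := by
  rw [lift_conv_image]
  exact ⟨mem_coneHull hv, h.ne_zero v⟩

/-- Each `P v` spans an extreme ray. If `P v` is a nonnegative combination of other vertices, then
for each such `u` some facet contains `v` but not `u`; its functional vanishes at `P v` and is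
positive at `P u`, so the coefficient of `u` is zero. -/
theorem mem_of_mem_lift_conv {F : Set (Fin n)} {v : Fin n}
    (hv : P v ∈ lift (conv ((fun v => ray (P v) (h.ne_zero v)) '' F))) : v ∈ F := by
  rw [lift_conv_image] at hv
  obtain ⟨⟨c, hc, hcF, hsum⟩, -⟩ := hv
  by_contra hvF
  refine h.ne_zero v (hsum.trans (Finset.sum_eq_zero fun u _ => ?_))
  by_cases hu : u ∈ F
  · have hvu : v ≠ u := fun h' => hvF (h' ▸ hu)
    obtain ⟨i, hi, hi'⟩ := h.separate v u hvu
    have h0 := (h.eq_zero_iff i v).2 hi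
    rw [hsum, map_sum, Finset.sum_eq_zero_iff_of_nonneg fun v _ => by
      rw [map_smul]
      exact mul_nonneg (hc v) (h.nonneg i v)] at h0
    have := h0 u (Finset.mem_univ u)
    rw [map_smul, smul_eq_mul, mul_eq_zero] at this
    rw [this.resolve_right fun h' => hi' ((h.eq_zero_iff i u).1 h'), zero_smul]
  · rw [hcF u hu, zero_smul]

theorem conv_subset_conv {F F' : Set (Fin n)} :
    conv ((fun v => ray (P v) (h.ne_zero v)) '' F) ⊆
      conv ((fun v => ray (P v) (h.ne_zero v)) '' F') ↔ F ⊆ F' := by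
  rw [← lift_subset_lift]
  constructor
  · exact fun hs v hv => h.mem_of_mem_lift_conv (hs (h.mem_lift_conv hv))
  · intro hs
    rw [lift_conv_image, lift_conv_image]
    rintro x ⟨⟨c, hc, hcF, hx⟩, hx0⟩
    exact ⟨⟨c, hc, fun v hv => hcF v fun h' => hv (hs h'), hx⟩, hx0⟩

theorem conv_inj {F F' : Set (Fin n)} :
    conv ((fun v => ray (P v) (h.ne_zero v)) '' F) =
      conv ((fun v => ray (P v) (h.ne_zero v)) '' F') ↔ F = F' := by
  rw [Subset.antisymm_iff, Subset.antisymm_iff, h.conv_subset_conv, h.conv_subset_conv]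

theorem isFace_conv {F : Finset (Fin n)} (hF : G.IsFace F) :
    IsFace (conv (range fun v => ray (P v) (h.ne_zero v)))
      (conv ((fun v => ray (P v) (h.ne_zero v)) '' (F : Set (Fin n)))) := by
  obtain ⟨⟨v, hv⟩, I, ⟨i, hi⟩, hI⟩ := hF
  refine ⟨⟨_, (h.mem_lift_conv (F := F) hv).2⟩, ?_, ∑ i ∈ I, γ i, ?_⟩
  · rw [← image_univ, Ne, h.conv_inj]
    intro heq
    obtain ⟨u, hu⟩ := h.facet_ne i
    have : u ∈ (F : Set (Fin n)) := heq ▸ mem_univ u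
    exact hu ((hI u).1 this i hi)
  · have hnn : ∀ v, 0 ≤ (∑ i ∈ I, γ i) (P v) := fun v => by
      rw [sum_apply]
      exact Finset.sum_nonneg fun i _ => h.nonneg i v
    refine ⟨h.nonneg_on_lift hnn, h.inter_ker hnn fun v => ?_⟩
    rw [sum_apply, Finset.sum_eq_zero_iff_of_nonneg fun i _ => h.nonneg i v]
    simp only [h.eq_zero_iff]
    exact hI v

/-- By the field `dual`, a supporting functional is a nonnegative combination of the `γ i`. A vertex
lies on its zero set exactly when it lies on every facet with nonzero coefficient, so the face is an
intersection of facets. If all coefficients vanish, the face is the whole polytope, which is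
excluded. -/
theorem exists_face {F : Set PSphere}
    (hF : IsFace (conv (range fun v => ray (P v) (h.ne_zero v))) F) :
    ∃ S : Finset (Fin n), G.IsFace S ∧
      conv ((fun v => ray (P v) (h.ne_zero v)) '' (S : Set (Fin n))) = F := by
  classical
  obtain ⟨hne, hnt, α, hpos, rfl⟩ := hF
  have hα : ∀ v, 0 ≤ α (P v) := fun v =>
    hpos _ (by rw [← image_univ]; exact h.mem_lift_conv (mem_univ v))
  have hS : ∀ v, v ∈ ((Finset.univ.filter fun v => α (P v) = 0 : Finset (Fin n)) : Set (Fin n)) ↔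
      α (P v) = 0 := by simp
  have heq := h.inter_ker hα hS
  refine ⟨_, ⟨?_, ?_⟩, heq⟩
  · rw [← heq] at hne
    obtain ⟨x, hx⟩ := hne
    obtain ⟨v, hv, rfl⟩ := exists_eq_ray x
    have : v ∈ lift _ := ⟨hv, hx⟩
    rw [lift_conv_image] at this
    obtain ⟨⟨c, -, hc, rfl⟩, -⟩ := this
    by_contra hemp
    rw [Finset.not_nonempty_iff_eq_empty] at hemp
    refine hv (Finset.sum_eq_zero fun v _ => ?_)
    rw [hc v (by rw [hemp]; simp), zero_smul]
  · obtain ⟨c, hc, hαc⟩ := h.dual α hα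
    have hz : ∀ v, α (P v) = 0 ↔ ∀ i ∈ Finset.univ.filter (fun i => c i ≠ 0), v ∈ G.facet i := by
      intro v
      rw [hαc, Finset.sum_eq_zero_iff_of_nonneg fun i _ => mul_nonneg (hc i) (h.nonneg i v)]
      simp only [Finset.mem_univ, true_implies, mul_eq_zero, h.eq_zero_iff, Finset.mem_filter,
        true_and]
      exact forall_congr' fun i => or_iff_not_imp_left
    refine ⟨Finset.univ.filter fun i => c i ≠ 0, ?_, fun v => ?_⟩
    · by_contra hemp
      rw [Finset.not_nonempty_iff_eq_empty] at hemp
      simp only [hemp, Finset.notMem_empty, false_implies, implies_true, iff_true] at hz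
      apply hnt
      rw [← heq, ← image_univ]
      congr 2
      ext v
      simp [hz v]
    · rw [← hz v]
      simp

theorem span_lift_conv (F : Set (Fin n)) :
    Submodule.span ℝ (lift (conv ((fun v => ray (P v) (h.ne_zero v)) '' F))) =
      Submodule.span ℝ (P '' F) := by
  apply le_antisymm
  · rw [Submodule.span_le, lift_conv_image]
    rintro _ ⟨⟨c, -, hcF, rfl⟩, -⟩
    refine Submodule.sum_mem _ fun v _ => ?_
    by_cases hv : v ∈ F
    · exact Submodule.smul_mem _ _ (Submodule.subset_span ⟨v, hv, rfl⟩)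
    · rw [hcF v hv, zero_smul]
      exact Submodule.zero_mem _
  · rw [Submodule.span_le]
    rintro _ ⟨v, hv, rfl⟩
    exact Submodule.subset_span (h.mem_lift_conv hv)

theorem exists_interior : ∃ x : V, x ≠ 0 ∧ ∀ i, 0 < γ i x := by
  have hpos : ∀ i, 0 < γ i (∑ v, P v) := fun i => by
    rw [map_sum]
    obtain ⟨v, hv⟩ := h.facet_ne i
    refine Finset.sum_pos' (fun v _ => h.nonneg i v) ⟨v, Finset.mem_univ v, ?_⟩
    exact lt_of_le_of_ne (h.nonneg i v) fun h0 => hv ((h.eq_zero_iff i v).1 h0.symm)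
  refine ⟨∑ v, P v, fun h0 => ?_, hpos⟩
  obtain ⟨φ, -, hφ⟩ := h.pos
  have hv : ∀ v, 0 < φ (P v) := fun v => hφ _ (fun i => h.nonneg i v) (h.ne_zero v)
  have : 0 < φ (∑ v, P v) := by
    rw [map_sum]
    exact Finset.sum_pos (fun v _ => hv v) ⟨⟨0, h.vertex_pos⟩, Finset.mem_univ _⟩
  rw [h0, map_zero] at this
  exact this.false

theorem pair_eq_zero {u v : Fin n} (huv : u ≠ v) {a b : ℝ} (hab : a • P u + b • P v = 0) :
    a = 0 ∧ b = 0 := by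
  have key : ∀ {u v : Fin n}, u ≠ v → ∀ {a b : ℝ}, a • P u + b • P v = 0 → a = 0 := by
    intro u v huv a b hab
    obtain ⟨i, hi, hi'⟩ := h.separate v u huv.symm
    have := congrArg (γ i) hab
    rw [map_add, map_smul, map_smul, (h.eq_zero_iff i v).2 hi, smul_zero, add_zero, map_zero,
      smul_eq_mul, mul_eq_zero] at this
    exact this.resolve_right fun h' => hi' ((h.eq_zero_iff i u).1 h')
  exact ⟨key huv hab, key huv.symm (by rwa [add_comm])⟩

theorem functional_ne_zero (i : Fin f) : γ i ≠ 0 := fun h0 => by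
  obtain ⟨v, hv⟩ := h.facet_ne i
  exact hv ((h.eq_zero_iff i v).1 (by rw [h0]; rfl))

theorem exists_dual_vector {i j : Fin f} (hij : i ≠ j) : ∃ x, γ i x = 1 ∧ γ j x = 0 := by
  obtain ⟨v, hv, hv'⟩ := h.facet_diff j i hij.symm
  have h0 : γ i (P v) ≠ 0 := fun h0 => hv' ((h.eq_zero_iff i v).1 h0)
  refine ⟨(γ i (P v))⁻¹ • P v, ?_, ?_⟩
  · rw [map_smul, smul_eq_mul, inv_mul_cancel₀ h0]
  · rw [map_smul, (h.eq_zero_iff j v).2 hv, smul_zero]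

theorem finrank_span_facet (i : Fin f) :
    Module.finrank ℝ (Submodule.span ℝ (P '' (G.facet i : Set (Fin n)))) = 3 := by
  apply le_antisymm
  · have hlt : Submodule.span ℝ (P '' (G.facet i : Set (Fin n))) < ⊤ := by
      refine lt_of_le_of_lt (b := LinearMap.ker (γ i : V →ₗ[ℝ] ℝ)) ?_ (lt_top_iff_ne_top.2 ?_)
      · rw [Submodule.span_le]
        rintro _ ⟨v, hv, rfl⟩
        exact (h.eq_zero_iff i v).2 hv
      · intro htop
        rw [LinearMap.ker_eq_top] at htop
        exact h.functional_ne_zero i (ContinuousLinearMap.ext fun x => LinearMap.congr_fun htop x)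
    have := Submodule.finrank_lt hlt.ne
    rw [Module.finrank_fin_fun] at this
    omega
  · obtain ⟨u, v, w, j, huv, hu, hv, hw, hu', hv', hw'⟩ := h.facet_triple i
    have hli : LinearIndependent ℝ ![P u, P v, P w] := by
      rw [Fintype.linearIndependent_iff]
      intro g hg
      rw [Fin.sum_univ_three] at hg
      change g 0 • P u + g 1 • P v + g 2 • P w = 0 at hg
      have hc := congrArg (γ j) hg
      rw [map_add, map_add, map_smul, map_smul, map_smul, (h.eq_zero_iff j u).2 hu',
        (h.eq_zero_iff j v).2 hv', smul_zero, smul_zero, zero_add, zero_add, map_zero,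
        smul_eq_mul, mul_eq_zero] at hc
      have hc := hc.resolve_right fun h' => hw' ((h.eq_zero_iff j w).1 h')
      rw [hc, zero_smul, add_zero] at hg
      obtain ⟨ha, hb⟩ := h.pair_eq_zero huv hg
      intro k
      fin_cases k <;> assumption
    have hcard := finrank_span_eq_card hli
    rw [Fintype.card_fin] at hcard
    refine hcard.symm.le.trans ?_
    refine Submodule.finrank_mono (Submodule.span_mono ?_)
    rintro _ ⟨k, rfl⟩
    fin_cases k
    exacts [⟨u, hu, rfl⟩, ⟨v, hv, rfl⟩, ⟨w, hw, rfl⟩]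

theorem finrank_span {F : Finset (Fin n)} (hF : G.IsFace F) :
    Module.finrank ℝ (Submodule.span ℝ (P '' (F : Set (Fin n)))) = min (F.card - 1) 2 + 1 := by
  obtain ⟨hne, I, ⟨i, hi⟩, hI⟩ := hF
  have hpos := hne.card_pos
  rcases lt_trichotomy F.card 2 with hc | hc | hc
  · obtain ⟨v, rfl⟩ := Finset.card_eq_one.1 (show F.card = 1 by omega)
    rw [Finset.coe_singleton, image_singleton, finrank_span_singleton (h.ne_zero v)]
    rfl
  · obtain ⟨u, v, huv, rfl⟩ := Finset.card_eq_two.1 hc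
    have hli : LinearIndependent ℝ ![P u, P v] :=
      LinearIndependent.pair_iff.2 fun a b hab => h.pair_eq_zero huv hab
    have := finrank_span_eq_card hli
    rw [Matrix.range_cons_cons_empty] at this
    rw [hc, Finset.coe_pair, image_pair, this]
    rfl
  -- Two facets share at most two vertices, so a face with three or more vertices lies in only one
  -- facet.
  · have hF : F = G.facet i := by
      ext v
      rw [hI]
      refine ⟨fun h' => h' i hi, fun hv j hj => ?_⟩
      by_contra hvj
      have hij : i ≠ j := fun h' => hvj (h' ▸ hv)
      have hsub : F ⊆ G.facet i ∩ G.facet j := fun u hu =>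
        Finset.mem_inter.2 ⟨(hI u).1 hu i hi, (hI u).1 hu j hj⟩
      have := (Finset.card_le_card hsub).trans (h.card_inter i j hij)
      omega
    rw [show min (F.card - 1) 2 + 1 = 3 by omega, hF, h.finrank_span_facet]

/-- A functional supporting a facet is determined up to a positive factor. -/
theorem exists_eq_smul_of_supports {i : Fin f} {α : VDual} (hα0 : α ≠ 0)
    (hα : ∀ v, 0 ≤ α (P v)) (hi : ∀ v ∈ G.facet i, α (P v) = 0) :
    ∃ c : ℝ, 0 < c ∧ α = c • γ i := by
  obtain ⟨c, hc, hαc⟩ := h.dual α hα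
  have hcz : ∀ j, j ≠ i → c j = 0 := by
    intro j hj
    obtain ⟨v, hv, hv'⟩ := h.facet_diff i j hj.symm
    have := hi v hv
    rw [hαc, Finset.sum_eq_zero_iff_of_nonneg fun i _ => mul_nonneg (hc i) (h.nonneg i v)] at this
    exact (mul_eq_zero.1 (this j (Finset.mem_univ j))).resolve_right
      fun h' => hv' ((h.eq_zero_iff j v).1 h')
  have heq : α = c i • γ i := by
    ext x
    rw [hαc, Finset.sum_eq_single i (fun j _ hj => by rw [hcz j hj, zero_mul])
      (fun h' => absurd (Finset.mem_univ i) h')]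
    rfl
  refine ⟨c i, lt_of_le_of_ne (hc i) fun h0 => hα0 ?_, heq⟩
  rw [heq, ← h0, zero_smul]

theorem isRealization : IsRealization G fun v => ray (P v) (h.ne_zero v) := by
  refine ⟨?_, ?_, ?_⟩
  · obtain ⟨φ, hφ0, hφ⟩ := h.pos
    obtain ⟨x, hx0, hx⟩ := h.exists_interior
    rw [h.polytope_eq]
    exact isConvexPolytope_proj hφ0 hφ hx0 hx
  · refine ⟨RelIso.ofSurjective (OrderEmbedding.ofMapLEIff
      (fun F => ⟨_, h.isFace_conv F.2⟩) fun F F' => ?_) ?_⟩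
    · change conv _ ⊆ conv _ ↔ _
      rw [h.conv_subset_conv]
      exact Finset.coe_subset
    · rintro ⟨F, hF⟩
      obtain ⟨S, hS, rfl⟩ := h.exists_face hF
      exact ⟨⟨S, hS⟩, rfl⟩
  · intro F k
    have hface : IsFace (conv (range fun v => ray (P v) (h.ne_zero v)))
        (conv ((fun v => ray (P v) (h.ne_zero v)) '' (F : Set (Fin n)))) ↔ G.IsFace F := by
      refine ⟨fun hF => ?_, h.isFace_conv⟩
      obtain ⟨S, hS, heq⟩ := h.exists_face hF
      rw [h.conv_inj, Finset.coe_inj] at heq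
      exact heq ▸ hS
    unfold IsFaceOfDim LabeledPolytope.IsFaceOfDim
    rw [hface, h.span_lift_conv]
    refine and_congr_right fun hF => ?_
    rw [h.finrank_span hF]
    exact Nat.add_right_cancel_iff

/-- The realization given by the vertices. -/
theorem definedBy : PreRealization.DefinedBy (⟨_, h.isRealization⟩ : PreRealization G) γ := by
  refine ⟨h.polytope_eq, fun i => ⟨h.nonneg_on_lift (h.nonneg i), h.inter_ker (h.nonneg i) ?_⟩⟩
  intro v
  rw [h.eq_zero_iff i]
  rfl

end ConeRealization

/-! ### The polytopes of the path -/

/-- The vertices of the polytope defined by `gammaPath s`. -/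
def pathVertex (s : ℝ) : Fin 8 → V :=
  ![![0, 0, 1, 0], ![1, 0, 0, 0], ![0, 1, 0, 0], ![0, 1, 2, 3], ![1, 0, 2 * (s - 1), 2 * s - 1],
    ![0, 0, 2, 1], ![1, 0, 0, 1], ![0, 1, 0, 1]]

section

variable (s : ℝ) (x : V)

@[simp] theorem gammaPath_zero : gammaPath s 0 x = x 0 := rfl
@[simp] theorem gammaPath_one : gammaPath s 1 x = x 1 := rfl
@[simp] theorem gammaPath_two : gammaPath s 2 x = x 2 := rfl
@[simp] theorem gammaPath_three : gammaPath s 3 x = x 3 := rfl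
@[simp] theorem gammaPath_four : gammaPath s 4 x = x 0 + x 1 + x 2 - x 3 := rfl
@[simp] theorem gammaPath_five :
    gammaPath s 5 x = s * x 0 + 2 * x 1 + 1 / 2 * x 2 - x 3 := rfl

end

theorem dual_apply (α : VDual) (x : V) :
    α x = α (Pi.single 0 1) * x 0 + α (Pi.single 1 1) * x 1 + α (Pi.single 2 1) * x 2 +
      α (Pi.single 3 1) * x 3 := by
  conv_lhs => rw [← Finset.univ_sum_single x]
  rw [map_sum, Fin.sum_univ_four]
  have : ∀ i, α (Pi.single i (x i)) = α (Pi.single i 1) * x i := fun i => by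
    rw [mul_comm, ← smul_eq_mul, ← map_smul, ← Pi.single_smul', smul_eq_mul, mul_one]
  simp only [this]

theorem forall_fin_six {p : Fin 6 → Prop} : (∀ i, p i) ↔ p 0 ∧ p 1 ∧ p 2 ∧ p 3 ∧ p 4 ∧ p 5 := by
  simp [Fin.forall_fin_succ]

/-- The hyperplane `x 3 = x 0 + x 1 + x 2 / 2` passes through the vertices 5, 6, 7 and cuts the
polytope into a piece with the vertices 0, 1, 2 and a piece with the vertices 3, 4. Explicit
coefficients are found on each side. -/
theorem mem_coneHull_pathVertex {s : ℝ} (hs : 1 < s) {x : V} (hx : ∀ i, 0 ≤ gammaPath s i x) :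
    x ∈ coneHull (pathVertex s) univ := by
  have of_coeff : ∀ c : Fin 8 → ℝ, (∀ v, 0 ≤ c v) → x 0 = c 1 + c 4 + c 6 →
      x 1 = c 2 + c 3 + c 7 → x 2 = c 0 + 2 * c 3 + 2 * (s - 1) * c 4 + 2 * c 5 →
      x 3 = 3 * c 3 + (2 * s - 1) * c 4 + c 5 + c 6 + c 7 → x ∈ coneHull (pathVertex s) univ := by
    intro c hc h0 h1 h2 h3
    refine ⟨c, hc, fun v hv => absurd (mem_univ v) hv, ?_⟩
    ext i
    rw [Fin.sum_univ_eight]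
    fin_cases i <;> simp [pathVertex, *] <;> ring
  rw [forall_fin_six] at hx
  simp only [gammaPath_zero, gammaPath_one, gammaPath_two, gammaPath_three, gammaPath_four,
    gammaPath_five] at hx
  obtain ⟨h0, h1, h2, h3, h4, h5⟩ := hx
  rcases le_total (x 3) (x 0 + x 1 + x 2 / 2) with h | h
  -- Vertices 6, 7, 5 are `e₁`, `e₂`, `2e₃` raised by one unit of `e₄`, so the height `x 3` is
  -- distributed among them greedily.
  · obtain ⟨a, b, c, ha, hb, hc, ha', hb', hc', hsum⟩ : ∃ a b c : ℝ, 0 ≤ a ∧ 0 ≤ b ∧ 0 ≤ c ∧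
        a ≤ x 0 ∧ b ≤ x 1 ∧ c ≤ x 2 / 2 ∧ a + b + c = x 3 := by
      rcases le_total (x 3) (x 0) with h' | h'
      · exact ⟨x 3, 0, 0, by linarith, le_rfl, le_rfl, h', h1, by linarith, by ring⟩
      rcases le_total (x 3) (x 0 + x 1) with h'' | h''
      · exact ⟨x 0, x 3 - x 0, 0, by linarith, by linarith, le_rfl, le_rfl, by linarith,
          by linarith, by ring⟩
      · exact ⟨x 0, x 1, x 3 - x 0 - x 1, h0, h1, by linarith, le_rfl, le_rfl, by linarith,
          by ring⟩
    refine of_coeff ![x 2 - 2 * c, x 0 - a, x 1 - b, 0, 0, c, a, b] ?_ ?_ ?_ ?_ ?_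
    · intro v
      fin_cases v <;> simp <;> linarith
    all_goals simp; try linarith
  -- Relative to vertices 5, 6, 7, the vertex 3 is `P 7 + P 5 + e₄` and the vertex 4 is `P 6 + (s -
  -- 1) P 5 + (s - 1) e₄`. They absorb the excess height; functional 5 says that there is enough
  -- room, and functional 4 that the coefficient of `P 5` stays nonnegative.
  · obtain ⟨a, b, ha, hb, ha', hb', hsum⟩ : ∃ a b : ℝ, 0 ≤ a ∧ 0 ≤ b ∧ a ≤ x 1 ∧ b ≤ x 0 ∧
        a + (s - 1) * b = x 3 - x 0 - x 1 - x 2 / 2 := by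
      rcases le_total (x 3 - x 0 - x 1 - x 2 / 2) (x 1) with h' | h'
      · exact ⟨_, 0, by linarith, le_rfl, h', h0, by ring⟩
      · have hs' : 0 < s - 1 := by linarith
        refine ⟨x 1, (x 3 - x 0 - x 1 - x 2 / 2 - x 1) / (s - 1), h1,
          div_nonneg (by linarith) hs'.le, le_rfl, ?_, ?_⟩
        · rw [div_le_iff₀ hs']
          linarith
        · field_simp
          ring
    refine of_coeff ![0, 0, 0, a, b, x 2 / 2 - a - (s - 1) * b, x 0 - b, x 1 - a] ?_ ?_ ?_ ?_ ?_
    · intro v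
      fin_cases v <;> simp <;> linarith
    all_goals simp; try linarith

theorem gammaPath_dual {s : ℝ} {α : VDual} (hα : ∀ v, 0 ≤ α (pathVertex s v)) :
    ∃ c : Fin 6 → ℝ, (∀ i, 0 ≤ c i) ∧ ∀ x, α x = ∑ i, c i * gammaPath s i x := by
  have e0 := hα 1
  have e1 := hα 2
  have e2 := hα 0
  have e3 := hα 3
  have e4 := hα 4
  have e5 := hα 5
  have e6 := hα 6
  have e7 := hα 7
  rw [dual_apply] at e0 e1 e2 e3 e4 e5 e6 e7
  simp only [pathVertex, Matrix.cons_val, mul_zero, mul_one, add_zero, zero_add]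
    at e0 e1 e2 e3 e4 e5 e6 e7
  have of_coeff : ∀ c : Fin 6 → ℝ, (∀ i, 0 ≤ c i) →
      α (Pi.single 0 1) = c 0 + c 4 + s * c 5 → α (Pi.single 1 1) = c 1 + c 4 + 2 * c 5 →
      α (Pi.single 2 1) = c 2 + c 4 + 1 / 2 * c 5 → α (Pi.single 3 1) = c 3 - c 4 - c 5 →
      ∃ c : Fin 6 → ℝ, (∀ i, 0 ≤ c i) ∧ ∀ x, α x = ∑ i, c i * gammaPath s i x := by
    intro c hc h0 h1 h2 h3
    refine ⟨c, hc, fun x => ?_⟩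
    rw [dual_apply, Fin.sum_univ_six, h0, h1, h2, h3]
    simp
    ring
  generalize α (Pi.single 0 1) = a0 at *
  generalize α (Pi.single 1 1) = a1 at *
  generalize α (Pi.single 2 1) = a2 at *
  generalize α (Pi.single 3 1) = a3 at *
  rcases le_total 0 a3 with h | h
  · refine of_coeff ![a0, a1, a2, a3, 0, 0] ?_ ?_ ?_ ?_ ?_
    · intro v
      fin_cases v <;> simp [*]
    all_goals simp
  -- When `a3 < 0`, the functionals 4 and 5 must supply `a3`; `l` is the share of functional 5. The
  -- smallest share compatible with the coordinate `a2` is chosen, and nonnegativity at the vertices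
  -- 3 to 7 shows that it suits the others.
  obtain ⟨l, hl, hl', h1, h2, h3⟩ : ∃ l : ℝ, 0 ≤ l ∧ l ≤ -a3 ∧ -a3 + (s - 1) * l ≤ a0 ∧
      -a3 + l ≤ a1 ∧ -a3 - l / 2 ≤ a2 := by
    rcases le_total (-a3) a2 with h' | h'
    · exact ⟨0, le_rfl, by linarith, by linarith, by linarith, by linarith⟩
    · exact ⟨2 * (-a3 - a2), by linarith, by linarith, by linarith, by linarith, by linarith⟩
  refine of_coeff ![a0 + a3 - (s - 1) * l, a1 + a3 - l, a2 + a3 + l / 2, 0, -a3 - l, l]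
    ?_ ?_ ?_ ?_ ?_
  · intro v
    fin_cases v <;> simp <;> linarith
  all_goals simp; try ring

theorem coneRealization_path {s : ℝ} (hs : 1 < s) :
    ConeRealization exampleG (pathVertex s) (gammaPath s) where
  nonneg i v := by
    fin_cases i <;> fin_cases v <;> simp [pathVertex] <;> linarith
  eq_zero_iff i v := by
    fin_cases i <;> fin_cases v <;> simp [pathVertex, exampleG] <;> linarith
  mem_cone _ := mem_coneHull_pathVertex hs
  dual _ := gammaPath_dual
  ne_zero v h := by
    fin_cases v <;> simp [pathVertex] at h
  separate := by decide
  facet_ne := by decide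
  facet_triple := by decide
  card_inter := by decide
  facet_diff := by decide
  vertex_pos := by norm_num
  pos := by
    have happ : ∀ x : V, (coord 0 + coord 1 + coord 2) x = x 0 + x 1 + x 2 := fun _ => rfl
    refine ⟨coord 0 + coord 1 + coord 2, fun h => ?_, fun x hx hx0 => ?_⟩
    · have := happ ![1, 0, 0, 0]
      rw [h] at this
      simp at this
    · rw [forall_fin_six] at hx
      simp only [gammaPath_zero, gammaPath_one, gammaPath_two, gammaPath_three, gammaPath_four,
        gammaPath_five] at hx
      obtain ⟨h0, h1, h2, h3, h4, h5⟩ := hx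
      rw [happ]
      refine lt_of_le_of_ne (by linarith) fun h => hx0 ?_
      ext i
      fin_cases i <;> simp <;> linarith

/-- The path of realizations of `exampleG`. -/
def pathRealization (s : Ioi (1 : ℝ)) : PreRealization exampleG :=
  ⟨_, (coneRealization_path s.2).isRealization⟩

theorem continuous_pathRealization : Continuous pathRealization := by
  refine Continuous.subtype_mk (continuous_pi fun v => ?_) _
  refine continuous_quot_mk.comp (Continuous.subtype_mk ?_ _)
  refine continuous_pi fun i => ?_
  fin_cases v <;> fin_cases i <;> simp [pathVertex] <;> fun_prop

theorem pathRealization_definedBy (s : Ioi (1 : ℝ)) :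
    (pathRealization s).DefinedBy (gammaPath s) :=
  (coneRealization_path s.2).definedBy

/-! ### Pairs of reflections -/

theorem SLpm_ext {g h : SLpm} (H : ∀ x, g.1 x = h.1 x) : g = h :=
  Subtype.ext (ContinuousLinearEquiv.ext (funext H))

theorem SLpm_mul_apply (g h : SLpm) (x : V) : (g * h).1 x = g.1 (h.1 x) := rfl

theorem SLpm_one_apply (x : V) : (1 : SLpm).1 x = x := rfl

/-- The reflection `Id - a ⊗ v`. -/
noncomputable def reflection (a : VDual) (v : V) (h : a v = 2) : SLpm :=
  have hinv : Function.LeftInverse ⇑(ContinuousLinearMap.id ℝ V - a.smulRight v)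
      ⇑(ContinuousLinearMap.id ℝ V - a.smulRight v) := fun x => by
    change x - a x • v - a (x - a x • v) • v = x
    rw [map_sub, map_smul, h, smul_eq_mul]
    module
  ⟨ContinuousLinearEquiv.equivOfInverse (ContinuousLinearMap.id ℝ V - a.smulRight v)
    (ContinuousLinearMap.id ℝ V - a.smulRight v) hinv hinv, by
    set f := ContinuousLinearMap.id ℝ V - a.smulRight v with hf
    change |LinearMap.det (f : V →ₗ[ℝ] V)| = 1
    have hmul : (f : V →ₗ[ℝ] V) * (f : V →ₗ[ℝ] V) = 1 := LinearMap.ext hinv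
    have := congrArg LinearMap.det hmul
    rw [map_mul, map_one, ← abs_mul_abs_self] at this
    nlinarith [abs_nonneg (LinearMap.det (f : V →ₗ[ℝ] V))]⟩

section RankTwo

variable {α β : VDual} {v w : V} {r r' : SLpm}

theorem commute_of_orthogonal (hr : ∀ x, r.1 x = x - α x • v) (hr' : ∀ x, r'.1 x = x - β x • w)
    (hv : α v = 2) (hw : β w = 2) (ha : α w = 0) (hb : β v = 0) : (r * r') ^ 2 = 1 := by
  refine SLpm_ext fun x => ?_
  simp only [pow_two, SLpm_mul_apply, SLpm_one_apply, hr, hr', map_sub, map_smul, hv, hw, ha, hb,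
    smul_eq_mul]
  module

theorem braid_three (hr : ∀ x, r.1 x = x - α x • v) (hr' : ∀ x, r'.1 x = x - β x • w)
    (hv : α v = 2) (hw : β w = 2) (h : α w * β v = 1) : (r * r') ^ 3 = 1 := by
  refine SLpm_ext fun x => ?_
  simp only [pow_succ, pow_zero, one_mul, SLpm_mul_apply, SLpm_one_apply, hr, hr', map_sub,
    map_smul, hv, hw, smul_eq_mul]
  generalize α w = a at *
  generalize β v = b at *
  generalize α x = p at *
  generalize β x = q at *
  match_scalars
  · ring
  · linear_combination (p * b - q * (a * b - 1)) * h
  · linear_combination (-p * (a * b - 1) + q * a * (a * b - 2)) * h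

theorem braid_four (hr : ∀ x, r.1 x = x - α x • v) (hr' : ∀ x, r'.1 x = x - β x • w)
    (hv : α v = 2) (hw : β w = 2) (h : α w * β v = 2) : (r * r') ^ 4 = 1 := by
  refine SLpm_ext fun x => ?_
  simp only [pow_succ, pow_zero, one_mul, SLpm_mul_apply, SLpm_one_apply, hr, hr', map_sub,
    map_smul, hv, hw, smul_eq_mul]
  generalize α w = a at *
  generalize β v = b at *
  generalize α x = p at *
  generalize β x = q at *
  have hb : b ≠ 0 := by
    rintro rfl
    norm_num at h
  obtain rfl : a = 2 / b := by
    field_simp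
    exact h
  match_scalars <;> field_simp <;> ring

variable {e e' : V} (h1 : α e = 1) (h2 : β e = 0) (h1' : α e' = 0) (h2' : β e' = 1)
include h1 h2 h1' h2'

theorem exists_values (p q : ℝ) : ∃ y, α y = p ∧ β y = q :=
  ⟨p • e + q • e', by simp [h1, h1'], by simp [h2, h2']⟩

theorem orthogonal_of_sq_eq_one (hr : ∀ x, r.1 x = x - α x • v) (hr' : ∀ x, r'.1 x = x - β x • w)
    (hv : α v = 2) (hw : β w = 2) (h : (r * r') ^ 2 = 1) : α w = 0 ∧ β v = 0 := by
  have hx : ∀ x, ((r * r') ^ 2).1 x = x := fun x => by rw [h, SLpm_one_apply]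
  simp only [pow_two, SLpm_mul_apply, hr, hr', map_sub, map_smul, hv, hw, smul_eq_mul] at hx
  have c1 := congrArg α (hx e)
  have c2 := congrArg β (hx e)
  have c3 := congrArg α (hx e')
  have c4 := congrArg β (hx e')
  simp only [map_sub, map_smul, hv, hw, h1, h2, h1', h2', smul_eq_mul] at c1 c2 c3 c4
  have hab : α w * β v = 0 := by linear_combination -c1
  constructor
  · linear_combination (-1 / 2 : ℝ) * c3 + α w / 2 * hab
  · linear_combination (1 / 2 : ℝ) * c2 + β v / 2 * hab

/-- With `e`, `e'` dual to `α`, `β`, the relation becomes polynomial equations in `a = α w` and `b =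
β v`. One leaves only `ab = 1` or `ab = 2`, and another excludes `ab = 2`. -/
theorem mul_eq_one_of_pow_three (hr : ∀ x, r.1 x = x - α x • v)
    (hr' : ∀ x, r'.1 x = x - β x • w) (hv : α v = 2) (hw : β w = 2) (h : (r * r') ^ 3 = 1) :
    α w * β v = 1 := by
  have hx : ∀ x, ((r * r') ^ 3).1 x = x := fun x => by rw [h, SLpm_one_apply]
  simp only [pow_succ, pow_zero, one_mul, SLpm_mul_apply, hr, hr', map_sub, map_smul, hv, hw,
    smul_eq_mul] at hx
  have c1 := congrArg α (hx e)
  have c3 := congrArg α (hx e')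
  simp only [map_sub, map_smul, hv, h1, h2, h1', h2', smul_eq_mul] at c1 c3
  generalize α w = a at *
  generalize β v = b at *
  have h3 : a * (a * b - 1) * (a * b - 3) = 0 := by linear_combination c3
  have h4 : (a * b - 1) * (a * b - 2) = 0 := by linear_combination -c1
  rcases mul_eq_zero.1 h4 with h5 | h5
  · linarith
  · rw [show a * b = 2 by linarith] at h3
    rw [show a = 0 by linarith] at h5
    norm_num at h5

theorem mul_eq_two_of_pow_four (hr : ∀ x, r.1 x = x - α x • v)
    (hr' : ∀ x, r'.1 x = x - β x • w) (hv : α v = 2) (hw : β w = 2) (h : (r * r') ^ 4 = 1)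
    (hne : (r * r') ^ 2 ≠ 1) : α w * β v = 2 := by
  have hx : ∀ x, ((r * r') ^ 4).1 x = x := fun x => by rw [h, SLpm_one_apply]
  simp only [pow_succ, pow_zero, one_mul, SLpm_mul_apply, hr, hr', map_sub, map_smul, hv, hw,
    smul_eq_mul] at hx
  have c1 := congrArg α (hx e)
  have c2 := congrArg β (hx e)
  have c3 := congrArg α (hx e')
  simp only [map_sub, map_smul, hv, hw, h1, h2, h1', h2', smul_eq_mul] at c1 c2 c3
  have hno : ¬ (α w = 0 ∧ β v = 0) := fun h0 => hne (commute_of_orthogonal hr hr' hv hw h0.1 h0.2)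
  generalize α w = a at *
  generalize β v = b at *
  have k1 : a * ((a * b - 2) * ((a * b - 2) ^ 2 - 2)) = 0 := by linear_combination c3
  have k2 : b * ((a * b - 2) * ((a * b - 2) ^ 2 - 2)) = 0 := by linear_combination -c2
  have k3 : a * b * ((a * b - 2) * (a * b - 3)) = 0 := by linear_combination -c1
  rcases mul_eq_zero.1 k3 with h5 | h5
  · rw [h5] at k1 k2
    exact absurd ⟨by linarith, by linarith⟩ hno
  rcases mul_eq_zero.1 h5 with h6 | h6
  · linarith
  · rw [show a * b = 3 by linarith] at k1
    rw [show a = 0 by linarith] at h6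
    norm_num at h6

/-- A wedge that is disjoint from its translates under a dihedral group of order `2m`,
`m ∈ {2, 3, 4}`, has the angle `π / m`. -/
theorem isCartanPair_of_wedge (hr : ∀ x, r.1 x = x - α x • v) (hr' : ∀ x, r'.1 x = x - β x • w)
    (hv : α v = 2) (hw : β w = 2) {m : ℕ} (hm : m = 2 ∨ m = 3 ∨ m = 4) (h : orderOf (r * r') = m)
    (hwedge : ∀ g ∈ Subgroup.closure {r, r'}, ∀ y, 0 < α y → 0 < β y → 0 < α (g.1 y) →
      0 < β (g.1 y) → g = 1) :
    IsCartanPair m (α w) (β v) := by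
  have hrm : r ∈ Subgroup.closure {r, r'} := Subgroup.subset_closure (by simp)
  have hrm' : r' ∈ Subgroup.closure {r, r'} := Subgroup.subset_closure (by simp)
  have hpow : (r * r') ^ m = 1 := h ▸ pow_orderOf_eq_one _
  have sign : ∀ {c : ℝ}, 0 < c → α w * β v = c → ¬ (0 < α w ∧ 0 < β v) →
      α w < 0 ∧ β v < 0 := by
    intro c hc hab hpos
    rcases mul_pos_iff.1 (hab.symm ▸ hc) with h | h
    · exact absurd h hpos
    · exact h
  rcases hm with rfl | rfl | rfl
  · exact Or.inl ⟨rfl, orthogonal_of_sq_eq_one h1 h2 h1' h2' hr hr' hv hw hpow⟩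
  · have hab := mul_eq_one_of_pow_three h1 h2 h1' h2' hr hr' hv hw hpow
    have hs := sign one_pos hab ?_
    · exact Or.inr ⟨hs.1, hs.2, Or.inl ⟨rfl, hab⟩⟩
    -- If both entries were positive, the nontrivial element `r r' r` would exchange `α` and `β` up
    -- to positive factors, hence preserve the wedge.
    rintro ⟨ha, hb⟩
    have ev : ∀ y, α ((r * r' * r).1 y) = α w * β y ∧ β ((r * r' * r).1 y) = β v * α y := by
      intro y
      simp only [SLpm_mul_apply, hr, hr', map_sub, map_smul, hv, hw, smul_eq_mul]
      constructor
      · linear_combination -(α y) * hab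
      · linear_combination (β y - α y * β v) * hab
    obtain ⟨y, hy, hy'⟩ := exists_values h1 h2 h1' h2' 1 1
    have h1g := hwedge _ (mul_mem (mul_mem hrm hrm') hrm) y (by rw [hy]; exact one_pos)
      (by rw [hy']; exact one_pos) (by rw [(ev y).1, hy', mul_one]; exact ha)
      (by rw [(ev y).2, hy, mul_one]; exact hb)
    have := (ev e).1
    rw [h1g, SLpm_one_apply, h1, h2, mul_zero] at this
    exact one_ne_zero this
  · have hab := mul_eq_two_of_pow_four h1 h2 h1' h2' hr hr' hv hw hpow fun h0 => by
      have := orderOf_dvd_of_pow_eq_one h0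
      rw [h] at this
      norm_num at this
    have hs := sign two_pos hab ?_
    · exact Or.inr ⟨hs.1, hs.2, Or.inr (Or.inl ⟨rfl, hab⟩)⟩
    rintro ⟨ha, hb⟩
    have ev : ∀ y, α ((r' * r).1 y) = α y - α w * β y ∧ β ((r' * r).1 y) = β v * α y - β y := by
      intro y
      simp only [SLpm_mul_apply, hr, hr', map_sub, map_smul, hv, hw, smul_eq_mul]
      constructor
      · linear_combination (α y) * hab
      · ring
    have hinv : 0 < (β v)⁻¹ := inv_pos.2 hb
    -- With `β y = 1`, the image under `r' r` stays in the wedge as soon as `α y` exceeds both `α w`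
    -- and `(β v)⁻¹`.
    obtain ⟨y, hy, hy'⟩ := exists_values h1 h2 h1' h2' (α w + 1 + (β v)⁻¹) 1
    have h1g := hwedge _ (mul_mem hrm' hrm) y (by rw [hy]; positivity)
      (by rw [hy']; exact one_pos) (by rw [(ev y).1, hy, hy']; linarith)
      (by
        rw [(ev y).2, hy, hy', mul_add, mul_inv_cancel₀ hb.ne']
        have : 0 < β v * (α w + 1) := by positivity
        linarith)
    have := (ev e').1
    rw [h1g, SLpm_one_apply, h1', h2'] at this
    linarith

omit h1 h2 h1' h2' in
theorem pow_eq_one_of_isCartanPair (hr : ∀ x, r.1 x = x - α x • v)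
    (hr' : ∀ x, r'.1 x = x - β x • w) (hv : α v = 2) (hw : β w = 2) {m : ℕ}
    (h : IsCartanPair m (α w) (β v)) : (r * r') ^ m = 1 := by
  rcases h with ⟨rfl, ha, hb⟩ | ⟨-, -, ⟨rfl, h⟩ | ⟨rfl, h⟩ | ⟨rfl, -⟩⟩
  · exact commute_of_orthogonal hr hr' hv hw ha hb
  · exact braid_three hr hr' hv hw h
  · exact braid_four hr hr' hv hw h
  · exact pow_zero _

theorem orderOf_eq_of_isCartanPair (hr : ∀ x, r.1 x = x - α x • v)
    (hr' : ∀ x, r'.1 x = x - β x • w) (hv : α v = 2) (hw : β w = 2) {m : ℕ} (hm : m ≠ 0)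
    (h : IsCartanPair m (α w) (β v)) : orderOf (r * r') = m := by
  have hpow := pow_eq_one_of_isCartanPair hr hr' hv hw h
  have hne : r * r' ≠ 1 := fun h0 => by
    have := congrArg (fun g : SLpm => α (g.1 e)) h0
    simp only [SLpm_mul_apply, SLpm_one_apply, hr, hr', h2, h1, map_sub, map_smul, hv,
      smul_eq_mul] at this
    norm_num at this
  rcases h with ⟨rfl, -, -⟩ | ⟨-, -, ⟨rfl, h⟩ | ⟨rfl, h⟩ | ⟨rfl, -⟩⟩
  · exact orderOf_eq_prime hpow hne
  · exact orderOf_eq_prime hpow hne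
  · refine orderOf_eq_prime_pow (p := 2) (n := 1) (fun h0 => ?_) hpow
    rw [pow_one] at h0
    have := orthogonal_of_sq_eq_one h1 h2 h1' h2' hr hr' hv hw h0
    rw [this.1, zero_mul] at h
    norm_num at h
  · exact absurd rfl hm

end RankTwo

/-! ### Coxeter polytopes over a given realization -/

section Transport

variable {n f : ℕ} {G : LabeledPolytope n f} {P : Fin n → V} {γ : Fin f → VDual}
  (h : ConeRealization G P γ) {X : CoxeterPolytope G} {g : SLpm}
  (hX : ∀ v, X.toPre.1 v = act g.1 (ray (P v) (h.ne_zero v)))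
include h hX

theorem apply_vertex_mem {F : Set (Fin n)} {v : Fin n} (hv : v ∈ F) :
    g.1 (P v) ∈ lift (conv (X.toPre.1 '' F)) := by
  refine subset_lift_conv _ ⟨fun h0 => h.ne_zero v (g.1.map_eq_zero_iff.1 h0), v, hv, ?_⟩
  rw [hX, act_ray]

theorem exists_functional_eq (j : Fin f) {α : VDual} (hα0 : α ≠ 0)
    (hα : Supports α X.toPre.polytope (X.toPre.facet j)) :
    ∃ c : ℝ, 0 < c ∧ ∀ x, α (g.1 x) = c * γ j x := by
  have hne : α.comp (g.1 : V →L[ℝ] V) ≠ 0 := fun h0 => hα0 (ContinuousLinearMap.ext fun x => by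
    have := congrArg (fun b : VDual => b (g.1.symm x)) h0
    change α (g.1 (g.1.symm x)) = 0 at this
    rwa [g.1.apply_symm_apply] at this)
  obtain ⟨c, hc, heq⟩ := h.exists_eq_smul_of_supports (i := j) hne
    (fun v => hα.1 _ (by
      have := apply_vertex_mem h hX (mem_univ v)
      rwa [image_univ] at this))
    (fun v hv => by
      have := apply_vertex_mem h hX (F := G.facet j) hv
      change _ ∈ lift (X.toPre.facet j) at this
      rw [hα.2, lift_inter, lift_proj (isPosCone_ker α)] at this
      exact this.2.1)
  exact ⟨c, hc, fun x => congrArg (fun b : VDual => b x) heq⟩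

/-- Supporting functionals of a facet are proportional, so after conjugation by `g` the scale can be
moved into the vector and every reflection written with the fixed functional `γ j`. -/
theorem exists_reflection_vectors : ∃ w : Fin f → V, (∀ j, γ j (w j) = 2) ∧
    ∀ j x, (g⁻¹ * X.refl j * g).1 x = x - γ j x • w j := by
  have key : ∀ j, ∃ w : V, γ j w = 2 ∧ ∀ x, (g⁻¹ * X.refl j * g).1 x = x - γ j x • w := by
    intro j
    obtain ⟨α, v, hv, hr, hs⟩ := X.refl_eq j
    obtain ⟨c, hc, hα⟩ := exists_functional_eq h hX j (fun h0 => by simp [h0] at hv) hs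
    refine ⟨c • g.1.symm v, ?_, fun x => ?_⟩
    · rw [map_smul, smul_eq_mul, ← hα, g.1.apply_symm_apply, hv]
    · change g.1.symm ((X.refl j).1 (g.1 x)) = _
      rw [hr, map_sub, map_smul, g.1.symm_apply_apply, hα]
      module
  choose w hw using key
  exact ⟨w, fun j => (hw j).1, fun j => (hw j).2⟩

theorem polytope_eq_proj : X.toPre.polytope =
    proj {y | ∀ i, 0 ≤ (γ i).comp (g.1.symm : V →L[ℝ] V) y} := by
  have hrange : range X.toPre.1 = act g.1 '' range fun v => ray (P v) (h.ne_zero v) := by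
    rw [← range_comp]
    exact congrArg range (funext hX)
  apply lift_injective
  unfold PreRealization.polytope
  rw [hrange, conv_act_image, lift_act_image, h.lift_polytope, lift_proj (isPosCone_nonneg _)]
  ext y
  constructor
  · rintro ⟨x, ⟨hx, hx0⟩, rfl⟩
    refine ⟨fun i => ?_, fun h0 => hx0 (g.1.map_eq_zero_iff.1 h0)⟩
    change 0 ≤ γ i (g.1.symm (g.1 x))
    rw [g.1.symm_apply_apply]
    exact hx i
  · rintro ⟨hy, hy0⟩
    exact ⟨g.1.symm y, ⟨hy, fun h0 => hy0 (g.1.symm.map_eq_zero_iff.1 h0)⟩,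
      g.1.apply_symm_apply y⟩

theorem interior_polytope : interior X.toPre.polytope =
    proj {y | ∀ i, 0 < (γ i).comp (g.1.symm : V →L[ℝ] V) y} := by
  rw [polytope_eq_proj h hX]
  refine interior_proj_nonneg fun i h0 =>
    h.functional_ne_zero i (ContinuousLinearMap.ext fun x => ?_)
  have := congrArg (fun b : VDual => b (g.1 x)) h0
  change γ i (g.1.symm (g.1 x)) = 0 at this
  rwa [g.1.symm_apply_apply] at this

theorem eq_one_of_chamber {k : SLpm}
    (hk : k ∈ Subgroup.closure (range fun j => g⁻¹ * X.refl j * g)) {x : V} (hx0 : x ≠ 0)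
    (hx : ∀ i, 0 < γ i x) (hkx : ∀ i, 0 < γ i (k.1 x)) : k = 1 := by
  have hmem : g * k * g⁻¹ ∈ Subgroup.closure (range X.refl) := by
    clear hkx
    induction hk using Subgroup.closure_induction with
    | mem y hy =>
      obtain ⟨j, rfl⟩ := hy
      refine Subgroup.subset_closure ⟨j, ?_⟩
      group
    | one => simp
    | mul y z _ _ hy hz =>
      have := mul_mem hy hz
      convert this using 1
      group
    | inv y _ hy =>
      have := inv_mem hy
      convert this using 1
      group
  by_contra hne
  have hne' : g * k * g⁻¹ ≠ 1 := fun h0 => hne (by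
    have := congrArg (fun y => g⁻¹ * y * g) h0
    simpa [mul_assoc] using this)
  have hdisj := X.tessellate _ hmem hne'
  rw [interior_polytope h hX] at hdisj
  have hgx : g.1 x ≠ 0 := fun h0 => hx0 (g.1.map_eq_zero_iff.1 h0)
  have hkx0 : k.1 x ≠ 0 := fun h0 => hx0 (k.1.map_eq_zero_iff.1 h0)
  have hgkx : g.1 (k.1 x) ≠ 0 := fun h0 => hkx0 (g.1.map_eq_zero_iff.1 h0)
  revert hdisj
  rw [imp_false, Set.not_disjoint_iff]
  refine ⟨ray _ hgkx, ⟨_, fun i => ?_, hgkx, rfl⟩, ray _ hgx, ⟨_, fun i => ?_, hgx, rfl⟩, ?_⟩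
  · change 0 < γ i (g.1.symm (g.1 (k.1 x)))
    rw [g.1.symm_apply_apply]
    exact hkx i
  · change 0 < γ i (g.1.symm (g.1 x))
    rw [g.1.symm_apply_apply]
    exact hx i
  · rw [act_ray]
    refine ray_eq_ray_iff.2 ⟨1, one_pos, ?_⟩
    rw [one_smul]
    change _ = g.1 (k.1 (g.1.symm (g.1 x)))
    rw [g.1.symm_apply_apply]

/-- Near a point of an edge the polytope is a wedge, which is disjoint from its translates. -/
theorem eq_one_of_wedge {i j : Fin f} {x₀ : V} (hi : γ i x₀ = 0) (hj : γ j x₀ = 0)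
    (hx₀ : ∀ k, k ≠ i → k ≠ j → 0 < γ k x₀) {w : Fin f → V}
    (hr : ∀ j x, (g⁻¹ * X.refl j * g).1 x = x - γ j x • w j) {k : SLpm}
    (hk : k ∈ Subgroup.closure {g⁻¹ * X.refl i * g, g⁻¹ * X.refl j * g}) {y : V}
    (hyi : 0 < γ i y) (hyj : 0 < γ j y) (hkyi : 0 < γ i (k.1 y)) (hkyj : 0 < γ j (k.1 y)) :
    k = 1 := by
  -- Both reflections fix the edge pointwise. Hence `k` sends `x₀ + e y` to `x₀ + e k(y)`, and for
  -- small `e > 0` both points are inside the polytope.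
  have hfix : k.1 x₀ = x₀ := by
    clear hkyi hkyj
    induction hk using Subgroup.closure_induction with
    | mem z hz =>
      rcases hz with rfl | rfl
      · rw [hr, hi, zero_smul, sub_zero]
      · rw [hr, hj, zero_smul, sub_zero]
    | one => rfl
    | mul z z' _ _ hz hz' => rw [SLpm_mul_apply, hz', hz]
    | inv z _ hz =>
      conv_lhs => rw [← hz]
      exact z.1.symm_apply_apply x₀
  have hsmall : ∀ z : V, 0 < γ i z → 0 < γ j z →
      ∀ᶠ e in 𝓝[>] (0 : ℝ), ∀ l, 0 < γ l (x₀ + e • z) := by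
    intro z hzi hzj
    refine Filter.eventually_all.2 fun l => ?_
    by_cases hl : l = i ∨ l = j
    · filter_upwards [self_mem_nhdsWithin] with e he
      have : γ l x₀ = 0 ∧ 0 < γ l z := by rcases hl with rfl | rfl <;> exact ⟨‹_›, ‹_›⟩
      rw [map_add, this.1, map_smul, zero_add]
      exact mul_pos he this.2
    · rw [not_or] at hl
      have hcont : Continuous fun e : ℝ => γ l (x₀ + e • z) := by fun_prop
      have := (hcont.tendsto 0).eventually (lt_mem_nhds (a := 0) (by
        simpa using hx₀ l hl.1 hl.2))
      exact this.filter_mono nhdsWithin_le_nhds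
  obtain ⟨e, h1, h2⟩ := ((hsmall y hyi hyj).and (hsmall _ hkyi hkyj)).exists
  refine eq_one_of_chamber h hX (Subgroup.closure_mono ?_ hk) (x := x₀ + e • y) ?_ h1 fun l => ?_
  · rintro z (rfl | rfl)
    exacts [⟨i, rfl⟩, ⟨j, rfl⟩]
  · intro h0
    have := h1 i
    rw [h0, map_zero] at this
    exact this.false
  · rw [map_add, map_smul, hfix]
    exact h2 l

theorem isCartanPair_of_adjacent {i j : Fin f} (hadj : G.Adjacent i j)
    (hedge : ∀ k, k ≠ i → k ≠ j → ∃ v, v ∈ G.facet i ∧ v ∈ G.facet j ∧ v ∉ G.facet k)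
    (hlabel : G.label i j = 2 ∨ G.label i j = 3 ∨ G.label i j = 4) {w : Fin f → V}
    (hw : ∀ j, γ j (w j) = 2) (hr : ∀ j x, (g⁻¹ * X.refl j * g).1 x = x - γ j x • w j) :
    IsCartanPair (G.label i j) (γ i (w j)) (γ j (w i)) := by
  obtain ⟨e, h1, h2⟩ := h.exists_dual_vector hadj.1
  obtain ⟨e', h2', h1'⟩ := h.exists_dual_vector hadj.1.symm
  have hord : orderOf ((g⁻¹ * X.refl i * g) * (g⁻¹ * X.refl j * g)) = G.label i j := by
    rw [← X.order_eq i j hadj, ← MulAut.conj_inv_apply, ← MulAut.conj_inv_apply, ← map_mul]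
    exact MulEquiv.orderOf_eq _ _
  set F := G.facet i ∩ G.facet j
  refine isCartanPair_of_wedge h1 h2 h1' h2' (hr i) (hr j) (hw i) (hw j) hlabel hord ?_
  intro k hk y hy hy' hky hky'
  -- The sum of the endpoints is interior to the edge: no third facet contains the whole edge, by
  -- `hedge`.
  refine eq_one_of_wedge h hX (x₀ := ∑ v ∈ F, P v) ?_ ?_ ?_ hr hk hy hy' hky hky'
  · rw [map_sum]
    exact Finset.sum_eq_zero fun v hv => (h.eq_zero_iff i v).2 (Finset.mem_inter.1 hv).1
  · rw [map_sum]
    exact Finset.sum_eq_zero fun v hv => (h.eq_zero_iff j v).2 (Finset.mem_inter.1 hv).2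
  · intro l hli hlj
    obtain ⟨v, hvi, hvj, hvl⟩ := hedge l hli hlj
    rw [map_sum]
    refine Finset.sum_pos' (fun v _ => h.nonneg l v) ⟨v, Finset.mem_inter.2 ⟨hvi, hvj⟩, ?_⟩
    exact lt_of_le_of_ne (h.nonneg l v) fun h0 => hvl ((h.eq_zero_iff l v).1 h0.symm)

end Transport

/-! ### The Cartan matrices over the path -/

theorem isCartanPair_two {a b : ℝ} : IsCartanPair 2 a b ↔ a = 0 ∧ b = 0 := by
  simp [IsCartanPair]

theorem isCartanPair_three {a b : ℝ} : IsCartanPair 3 a b ↔ a < 0 ∧ b < 0 ∧ a * b = 1 := by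
  simp [IsCartanPair]

theorem isCartanPair_four {a b : ℝ} : IsCartanPair 4 a b ↔ a < 0 ∧ b < 0 ∧ a * b = 2 := by
  simp [IsCartanPair]

theorem isCartanPair_zero_of_le {a b p q : ℝ} (hp : 0 < p) (hq : 0 < q) (hpq : 4 ≤ p * q)
    (ha : a ≤ -p) (hb : b ≤ -q) : IsCartanPair 0 a b :=
  Or.inr ⟨by linarith, by linarith, Or.inr (Or.inr ⟨rfl, by nlinarith⟩)⟩

theorem adjacent_iff {i j : Fin 6} :
    exampleG.Adjacent i j ↔ i ≠ j ∧ exampleG.label i j ≠ 0 := by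
  have key : ∀ i j : Fin 6, (i ≠ j ∧ min ((exampleG.facet i ∩ exampleG.facet j).card - 1) 2 = 1) ↔
      i ≠ j ∧ exampleG.label i j ≠ 0 := by decide
  rw [← key]
  refine and_congr_right fun _ => ⟨fun h => h.2, fun h => ⟨⟨?_, {i, j}, by simp, by simp⟩, h⟩⟩
  rw [← Finset.card_pos]
  by_contra h0
  rw [show (exampleG.facet i ∩ exampleG.facet j).card = 0 by omega] at h
  simp at h

/-- The Coxeter matrix of the labels; the value `0` stands for an infinite order. -/
def exampleMatrix : CoxeterMatrix (Fin 6) where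
  M := Matrix.of fun i j => if i = j then 1 else exampleG.label i j
  isSymm := by decide
  diagonal := by decide
  off_diagonal i j h := by
    rw [Matrix.of_apply, if_neg h]
    revert i j
    decide

theorem exampleMatrix_of_ne {i j : Fin 6} (h : i ≠ j) :
    exampleMatrix i j = exampleG.label i j := if_neg h

section

variable (s t : ℝ)

/-- The value of the functional `2` on the reflection vector `0`. -/
noncomputable def entry20 : ℝ := -4 * (s + t)

/-- The value of the functional `4` on the reflection vector `0`. -/
noncomputable def entry40 : ℝ := 2 - 4 * s - 3 * t

/-- The value of the functional `2` on the reflection vector `1`. -/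
noncomputable def entry21 : ℝ := -2 * s / t - 8

/-- The value of the functional `4` on the reflection vector `1`. -/
noncomputable def entry41 : ℝ := (1 - 2 * s) / t - 6

/-- The value of the functional `3` on the reflection vector `2`. -/
noncomputable def entry32 : ℝ := (entry20 s t)⁻¹ + 2 * (entry21 s t)⁻¹ + 2

/-- The value of the functional `5` on the reflection vector `4`. -/
noncomputable def entry54 : ℝ :=
  (s - 1) * (entry40 s t)⁻¹ + (entry41 s t)⁻¹ + 2

end

/-- The parameters for which the Cartan matrix has the right signs. -/
def paramSet (s : ℝ) : Set ℝ :=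
  {t | t < 0 ∧ entry20 s t < 0 ∧ entry40 s t < 0 ∧ entry21 s t < 0 ∧ entry41 s t < 0 ∧
    entry32 s t < 0 ∧ entry54 s t < 0}

/-- The reflection vectors over `gammaPath s` with parameter `t`. -/
noncomputable def pathVector (s t : ℝ) : Fin 6 → V :=
  ![![2, t, entry20 s t, 0], ![t⁻¹, 2, entry21 s t, 0],
    ![(entry20 s t)⁻¹, 2 * (entry21 s t)⁻¹, 2, entry32 s t], ![0, 0, (entry32 s t)⁻¹, 2],
    ![(entry40 s t)⁻¹, (entry41 s t)⁻¹, 0, (entry40 s t)⁻¹ + (entry41 s t)⁻¹ - 2],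
    ![0, 0, 2 * (entry54 s t)⁻¹ - 4, (entry54 s t)⁻¹ - 4]]

theorem gammaPath_pathVector_self (s t : ℝ) (j : Fin 6) :
    gammaPath s j (pathVector s t j) = 2 := by
  fin_cases j <;> simp [pathVector]
  ring

/-- The conditions can be solved one after another. The labels 2 on facets 3 and 5 give `w 0` and
then `w 1` from `t`; products with columns 0 and 1 give the first coordinates of `w 2` and `w 4`,
and the label 2 between facets 2 and 4 completes them. Finally `w 3` and `w 5` come from their only
labels 3, on the edges 23 and 45. Only the signs remain free. -/
theorem mem_paramSet_of_isCartanPair {s : ℝ} {w : Fin 6 → V}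
    (hw : ∀ j, gammaPath s j (w j) = 2)
    (hp : ∀ i j, exampleG.Adjacent i j →
      IsCartanPair (exampleG.label i j) (gammaPath s i (w j)) (gammaPath s j (w i))) :
    w 0 1 ∈ paramSet s ∧ w = pathVector s (w 0 1) := by
  have h03 := isCartanPair_two.1 (hp 0 3 (adjacent_iff.2 (by decide)))
  have h05 := isCartanPair_two.1 (hp 0 5 (adjacent_iff.2 (by decide)))
  have h13 := isCartanPair_two.1 (hp 1 3 (adjacent_iff.2 (by decide)))
  have h15 := isCartanPair_two.1 (hp 1 5 (adjacent_iff.2 (by decide)))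
  have h24 := isCartanPair_two.1 (hp 2 4 (adjacent_iff.2 (by decide)))
  have h01 := isCartanPair_three.1 (hp 0 1 (adjacent_iff.2 (by decide)))
  have h02 := isCartanPair_three.1 (hp 0 2 (adjacent_iff.2 (by decide)))
  have h04 := isCartanPair_three.1 (hp 0 4 (adjacent_iff.2 (by decide)))
  have h14 := isCartanPair_three.1 (hp 1 4 (adjacent_iff.2 (by decide)))
  have h23 := isCartanPair_three.1 (hp 2 3 (adjacent_iff.2 (by decide)))
  have h45 := isCartanPair_three.1 (hp 4 5 (adjacent_iff.2 (by decide)))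
  have h12 := isCartanPair_four.1 (hp 1 2 (adjacent_iff.2 (by decide)))
  rw [forall_fin_six] at hw
  clear hp
  simp only [gammaPath_zero, gammaPath_one, gammaPath_two, gammaPath_three, gammaPath_four,
    gammaPath_five] at *
  obtain ⟨k0, k1, k2, k3, k4, k5⟩ := hw
  set t := w 0 1 with ht
  have ht0 : t ≠ 0 := h01.2.1.ne
  have e01 : w 1 0 = t⁻¹ := eq_inv_of_mul_eq_one_left h01.2.2
  have e20 : w 0 2 = entry20 s t := by
    unfold entry20
    linear_combination 2 * h05.2 + 2 * h03.2 - 2 * s * k0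
  have e21 : w 1 2 = entry21 s t := by
    unfold entry21
    rw [e01] at h15
    linear_combination 2 * h15.2 + 2 * h13.2 - 4 * k1
  have e40 : w 0 0 + w 0 1 + w 0 2 - w 0 3 = entry40 s t := by
    rw [e20, k0, h03.2, entry20, entry40]
    ring
  have e41 : w 1 0 + w 1 1 + w 1 2 - w 1 3 = entry41 s t := by
    rw [e21, k1, h13.2, e01, entry21, entry41]
    ring
  rw [e20] at h02
  rw [e21] at h12
  rw [e40] at h04
  rw [e41] at h14
  have e02 : w 2 0 = (entry20 s t)⁻¹ := eq_inv_of_mul_eq_one_left h02.2.2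
  have e12 : w 2 1 = 2 * (entry21 s t)⁻¹ := by
    rw [← h12.2.2, mul_assoc, mul_inv_cancel₀ h12.2.1.ne, mul_one]
  have e32 : w 2 3 = entry32 s t := by
    rw [entry32, ← e02, ← e12]
    linear_combination k2 - h24.2
  rw [e32] at h23
  have e23 : w 3 2 = (entry32 s t)⁻¹ := eq_inv_of_mul_eq_one_left h23.2.2
  have e04 : w 4 0 = (entry40 s t)⁻¹ := eq_inv_of_mul_eq_one_left h04.2.2
  have e14 : w 4 1 = (entry41 s t)⁻¹ := eq_inv_of_mul_eq_one_left h14.2.2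
  have e34 : w 4 3 = (entry40 s t)⁻¹ + (entry41 s t)⁻¹ - 2 := by
    rw [← e04, ← e14]
    linear_combination h24.1 - k4
  have e54 : s * w 4 0 + 2 * w 4 1 + 1 / 2 * w 4 2 - w 4 3 = entry54 s t := by
    rw [e04, e14, e34, h24.1, entry54]
    ring
  rw [e54] at h45
  have e45 := eq_inv_of_mul_eq_one_left h45.2.2
  rw [h05.1, h15.1] at e45 k5
  refine ⟨⟨h01.2.1, h02.2.1, h04.2.1, h12.2.1, h14.2.1, h23.2.1, h45.2.1⟩, ?_⟩
  ext j i
  fin_cases j <;> fin_cases i <;> simp [pathVector, *]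
  · linear_combination 2 * e45 - 2 * k5
  · linear_combination e45 - 2 * k5

theorem isCartanPair_pathVector {s t : ℝ} (hs : 1 < s) (ht : t ∈ paramSet s) {i j : Fin 6}
    (hij : i ≠ j) :
    IsCartanPair (exampleMatrix i j) (gammaPath s i (pathVector s t j))
      (gammaPath s j (pathVector s t i)) := by
  obtain ⟨h1, h20, h40, h21, h41, h32, h54⟩ := ht
  have g54 : s * (entry40 s t)⁻¹ + 2 * (entry41 s t)⁻¹ -
      ((entry40 s t)⁻¹ + (entry41 s t)⁻¹ - 2) = entry54 s t := by
    rw [entry54]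
    ring
  have i20 := inv_lt_zero.2 h20
  have i40 := inv_lt_zero.2 h40
  have i21 := inv_lt_zero.2 h21
  have i41 := inv_lt_zero.2 h41
  have i32 := inv_lt_zero.2 h32
  have i54 := inv_lt_zero.2 h54
  have key : ∀ i j : Fin 6, i < j →
      IsCartanPair (exampleG.label i j) (gammaPath s i (pathVector s t j))
      (gammaPath s j (pathVector s t i)) := by
    intro i j hij
    fin_cases i <;> fin_cases j <;> try exact absurd hij (by decide)
    · exact isCartanPair_three.2 ⟨inv_lt_zero.2 h1, h1, inv_mul_cancel₀ h1.ne⟩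
    · exact isCartanPair_three.2 ⟨i20, h20, inv_mul_cancel₀ h20.ne⟩
    · exact isCartanPair_two.2 ⟨rfl, rfl⟩
    · have e : gammaPath s 4 (pathVector s t 0) = entry40 s t := by
        simp [pathVector, entry20, entry40]
        ring
      refine isCartanPair_three.2 ⟨i40, ?_, ?_⟩
      · exact e.trans_lt h40
      · exact (congrArg _ e).trans (inv_mul_cancel₀ h40.ne)
    · refine isCartanPair_two.2 ⟨rfl, ?_⟩
      simp [pathVector, entry20]
      ring
    · refine isCartanPair_four.2 ⟨?_, h21, ?_⟩
      · exact mul_neg_of_pos_of_neg two_pos i21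
      · exact inv_mul_cancel_right₀ h21.ne 2
    · exact isCartanPair_two.2 ⟨rfl, rfl⟩
    · have e : gammaPath s 4 (pathVector s t 1) = entry41 s t := by
        simp [pathVector, entry21, entry41]
        ring
      refine isCartanPair_three.2 ⟨i41, ?_, ?_⟩
      · exact e.trans_lt h41
      · exact (congrArg _ e).trans (inv_mul_cancel₀ h41.ne)
    · refine isCartanPair_two.2 ⟨rfl, ?_⟩
      simp [pathVector, entry21]
      ring
    · exact isCartanPair_three.2 ⟨i32, h32, inv_mul_cancel₀ h32.ne⟩
    · refine isCartanPair_two.2 ⟨rfl, ?_⟩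
      simp [pathVector, entry32]
    -- The pairs 25, 34 and 35 are the nonadjacent ones. Their entries are a negative constant plus
    -- terms made negative by the sign conditions and `s > 1`, and the constants alone already have
    -- product at least 4.
    · have e : gammaPath s 2 (pathVector s t 5) = 2 * (entry54 s t)⁻¹ - 4 := rfl
      have e' : gammaPath s 5 (pathVector s t 2) =
          (s - 1) * (entry20 s t)⁻¹ + 2 * (entry21 s t)⁻¹ - 1 := by
        simp [pathVector, entry32]
        ring
      have h' : gammaPath s 5 (pathVector s t 2) ≤ -1 := by
        rw [e']
        nlinarith
      have h : gammaPath s 2 (pathVector s t 5) ≤ -4 := by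
        rw [e]
        linarith
      exact isCartanPair_zero_of_le (p := 4) (q := 1) (by norm_num) (by norm_num) (by norm_num) h h'
    · refine isCartanPair_zero_of_le two_pos two_pos (by norm_num) ?_ ?_
      · simp [pathVector]
        linarith
      · simp [pathVector]
        linarith
    · refine isCartanPair_zero_of_le two_pos two_pos (by norm_num) ?_ ?_
      · simp [pathVector]
        linarith
      · simp [pathVector]
        linarith
    · have e : gammaPath s 5 (pathVector s t 4) = entry54 s t := by
        rw [← g54]
        simp [pathVector]
      have e' : gammaPath s 4 (pathVector s t 5) = (entry54 s t)⁻¹ := by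
        simp [pathVector]
        ring
      refine isCartanPair_three.2 ⟨?_, ?_, ?_⟩
      · exact e'.trans_lt i54
      · exact e.trans_lt h54
      · exact (congrArg₂ _ e' e).trans (inv_mul_cancel₀ h54.ne)
  rw [exampleMatrix_of_ne hij]
  rcases lt_or_gt_of_ne hij with h | h
  · exact key i j h
  · have hsymm : exampleG.label i j = exampleG.label j i := by
      revert i j
      decide
    rw [hsymm]
    exact (key j i h).symm

/-! ### The fibers over the path -/

/-- The reflections of the Coxeter polytope over `gammaPath s` with parameter `t`. -/
noncomputable def pathReflection (s t : ℝ) (j : Fin 6) : SLpm :=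
  reflection (gammaPath s j) (pathVector s t j) (gammaPath_pathVector_self s t j)

theorem pathReflection_apply (s t : ℝ) (j : Fin 6) (x : V) :
    (pathReflection s t j).1 x = x - gammaPath s j x • pathVector s t j := rfl

theorem exampleMatrix_isLiftable {s t : ℝ} (hs : 1 < s) (ht : t ∈ paramSet s) :
    exampleMatrix.IsLiftable (pathReflection s t) := by
  intro i j
  by_cases hij : i = j
  · subst hij
    rw [exampleMatrix.diagonal, pow_one]
    refine SLpm_ext fun x => ?_
    rw [SLpm_mul_apply, pathReflection_apply, pathReflection_apply, map_sub, map_smul,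
      gammaPath_pathVector_self, SLpm_one_apply, smul_eq_mul]
    module
  · exact pow_eq_one_of_isCartanPair (pathReflection_apply s t i) (pathReflection_apply s t j)
      (gammaPath_pathVector_self s t i) (gammaPath_pathVector_self s t j)
      (isCartanPair_pathVector hs ht hij)

theorem pathReflection_tessellate {s t : ℝ} (hs : 1 < s) (ht : t ∈ paramSet s) {k : SLpm}
    (hk : k ∈ Subgroup.closure (range (pathReflection s t))) {x : V}
    (hx : ∀ i, 0 < gammaPath s i x) (hkx : ∀ i, 0 < gammaPath s i (k.1 x)) : k = 1 := by
  -- The reflection group is the image of the abstract Coxeter group, where word length and descents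
  -- make sense. The latter acts on `V` through `φ`, and its chamber theorem is transported.
  set cs := exampleMatrix.toCoxeterSystem
  set φ : exampleMatrix.Group →* SLpm := cs.lift ⟨_, exampleMatrix_isLiftable hs ht⟩
  have hφ : ∀ j, φ (cs.simple j) = pathReflection s t j :=
    fun j => cs.lift_apply_simple (exampleMatrix_isLiftable hs ht) j
  obtain ⟨w, rfl⟩ : ∃ w, φ w = k := by
    have : Subgroup.closure (range (pathReflection s t)) ≤ φ.range := by
      rw [Subgroup.closure_le]
      rintro _ ⟨j, rfl⟩
      exact ⟨_, hφ j⟩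
    exact this hk
  let _ : MulAction exampleMatrix.Group V :=
    { smul := fun w x => (φ w).1 x
      one_smul := fun x => by
        change (φ 1).1 x = x
        rw [map_one, SLpm_one_apply]
      mul_smul := fun w w' x => by
        change (φ (w * w')).1 x = (φ w).1 ((φ w').1 x)
        rw [map_mul, SLpm_mul_apply] }
  have hw := eq_one_of_chamber_inter cs (α := fun i x => gammaPath s i x)
    (A := fun i j => gammaPath s i (pathVector s t j)) (gammaPath_pathVector_self s t)
    (fun i j hij => isCartanPair_pathVector hs ht hij)
    (fun i j x => by
      change gammaPath s i ((φ (cs.simple j)).1 x) = _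
      rw [hφ, pathReflection_apply, map_sub, map_smul, smul_eq_mul, mul_comm]) hx hkx
  rw [hw, map_one]

/-- The Coxeter polytope over `gammaPath s` with parameter `t`. -/
noncomputable def pathCoxeter (s : Ioi (1 : ℝ)) (t : paramSet s) : CoxeterPolytope exampleG where
  toPre := pathRealization s
  refl := pathReflection s t
  refl_eq j := ⟨gammaPath s j, pathVector s t j, gammaPath_pathVector_self s t j,
    pathReflection_apply s t j, (pathRealization_definedBy s).2 j⟩
  order_eq i j hij := by
    obtain ⟨e, h1, h2⟩ := (coneRealization_path s.2).exists_dual_vector hij.1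
    obtain ⟨e', h2', h1'⟩ := (coneRealization_path s.2).exists_dual_vector hij.1.symm
    refine orderOf_eq_of_isCartanPair h1 h2 h1' h2' (pathReflection_apply s t i)
      (pathReflection_apply s t j) (gammaPath_pathVector_self s t i)
      (gammaPath_pathVector_self s t j) (adjacent_iff.1 hij).2 ?_
    rw [← exampleMatrix_of_ne hij.1]
    exact isCartanPair_pathVector s.2 t.2 hij.1
  tessellate k hk hk1 := by
    have hα : ∀ i, gammaPath s i ≠ 0 := (coneRealization_path s.2).functional_ne_zero
    rw [(pathRealization_definedBy s).1, interior_proj_nonneg hα, Set.disjoint_left]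
    rintro _ ⟨y, hy, hy0, rfl⟩ ⟨_, ⟨x, hx, hx0, rfl⟩, h⟩
    rw [act_ray] at h
    obtain ⟨c, hc, rfl⟩ := ray_eq_ray_iff.1 h
    refine hk1 (pathReflection_tessellate s.2 t.2 hk hx fun i => ?_)
    have := hy i
    rw [map_smul, smul_eq_mul] at this
    exact (mul_pos_iff_of_pos_left hc).1 this

/-- Every Coxeter polytope over `gammaPath s` is equivalent to one of the family. -/
theorem exists_pathCoxeter (s : Ioi (1 : ℝ)) {X : CoxeterPolytope exampleG}
    (hX : (Quotient.mk _ X.toPre : RealizationSpace exampleG) = Quotient.mk _ (pathRealization s)) :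
    ∃ t : paramSet s, (Quotient.mk _ (pathCoxeter s t) : DeformationSpace exampleG) =
      Quotient.mk _ X := by
  obtain ⟨g, hg⟩ := Quotient.exact hX.symm
  have h := coneRealization_path s.2
  obtain ⟨w, hw, hr⟩ := exists_reflection_vectors h hg
  have hp : ∀ i j, exampleG.Adjacent i j →
      IsCartanPair (exampleG.label i j) (gammaPath s i (w j)) (gammaPath s j (w i)) := by
    intro i j hij
    have hne := adjacent_iff.1 hij
    refine isCartanPair_of_adjacent h hg hij ?_ ?_ hw hr
    · clear hij
      revert i j
      decide
    · clear hij
      revert i j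
      decide
  obtain ⟨ht, hwt⟩ := mem_paramSet_of_isCartanPair hw hp
  refine ⟨⟨_, ht⟩, Quotient.sound ⟨g, hg, fun j => ?_⟩⟩
  have : pathReflection s (w 0 1) j = g⁻¹ * X.refl j * g := SLpm_ext fun x => by
    rw [pathReflection_apply, hr, ← hwt]
  change X.refl j = g * pathReflection s (w 0 1) j * g⁻¹
  rw [this]
  group

theorem orbitMap_pathCoxeter (s : Ioi (1 : ℝ)) (t : paramSet s) :
    orbitMap exampleG (Quotient.mk _ (pathCoxeter s t)) =
      Quotient.mk (pairSetoid 6) (gammaPath s, pathVector s t) := by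
  refine Quotient.sound ?_
  have h := coneRealization_path s.2
  have key : ∀ j, ∃ c : ℝ, 0 < c ∧
      gammaPath s j = c⁻¹ • (pathCoxeter s t).functional j ∧
      pathVector s t j = c • (pathCoxeter s t).vector j := by
    intro j
    obtain ⟨hv, hr, hs⟩ := (pathCoxeter s t).spec j
    obtain ⟨c, hc, hα⟩ := exists_functional_eq h (X := pathCoxeter s t) (g := 1)
      (fun v => rfl) j (fun h0 => by simp [h0] at hv) hs
    replace hα : (pathCoxeter s t).functional j = c • gammaPath s j :=
      ContinuousLinearMap.ext hα
    refine ⟨c, hc, ?_, ?_⟩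
    · rw [hα, smul_smul, inv_mul_cancel₀ hc.ne', one_smul]
    · have h1 := hr (pathVector s t j)
      have h2 : (pathCoxeter s t).refl j = pathReflection s t j := rfl
      rw [h2, pathReflection_apply, hα] at h1
      have h3 := sub_right_injective h1
      change _ = (c * gammaPath s j _) • _ at h3
      rw [gammaPath_pathVector_self] at h3
      have h4 : (2 : ℝ) • pathVector s t j = (2 : ℝ) • c • (pathCoxeter s t).vector j := by
        rw [h3, smul_smul, mul_comm]
      exact smul_right_injective V two_ne_zero h4
  choose c hc hα hv using key
  refine ⟨1, c, hc, fun j => ⟨?_, hv j⟩⟩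
  rw [inv_one]
  exact hα j

/-- A cyclic product of the Cartan matrix, which is invariant under rescaling. -/
noncomputable def cyclicProduct : PairSpace 6 → ℝ :=
  Quotient.lift (fun a => a.1 1 (a.2 0) * a.1 2 (a.2 1) * a.1 0 (a.2 2)) (by
    rintro a b ⟨A, c, hc, h⟩
    have key : ∀ i j, b.1 i (b.2 j) = (c i)⁻¹ * c j * a.1 i (a.2 j) := by
      intro i j
      rw [(h i).1, (h j).2]
      change (c i)⁻¹ * a.1 i (A.1.symm (c j • A.1 (a.2 j))) = _
      rw [map_smul, A.1.symm_apply_apply, map_smul, smul_eq_mul, mul_assoc]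
    have h0 := (hc 0).ne'
    have h1 := (hc 1).ne'
    have h2 := (hc 2).ne'
    simp only [key]
    field_simp)

theorem continuous_cyclicProduct : Continuous cyclicProduct :=
  Continuous.quotient_lift (by fun_prop) _

/-- On the family the cyclic product is `(s + 4t) / (2(s + t))`, a Möbius function of `t` that never
takes the value 2. Inverting it recovers `t` continuously from the orbit. -/
theorem cyclicProduct_pathVector {s t : ℝ} (hs : 1 < s) (ht : t ∈ paramSet s) :
    cyclicProduct (Quotient.mk (pairSetoid 6) (gammaPath s, pathVector s t)) ≠ 2 ∧
    t = s * (1 - 2 * cyclicProduct (Quotient.mk (pairSetoid 6) (gammaPath s, pathVector s t))) /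
      (2 * (cyclicProduct (Quotient.mk (pairSetoid 6) (gammaPath s, pathVector s t)) - 2)) := by
  have h1 := ht.1.ne
  have h2 : s + t ≠ 0 := fun h0 => by
    have := ht.2.1
    rw [entry20, h0] at this
    norm_num at this
  have hc : cyclicProduct (Quotient.mk (pairSetoid 6) (gammaPath s, pathVector s t)) =
      (s + 4 * t) / (2 * (s + t)) := by
    change t * entry21 s t * (entry20 s t)⁻¹ = _
    rw [entry21, entry20]
    field_simp
    ring
  have hne : (s + 4 * t) / (2 * (s + t)) - 2 = -3 * s / (2 * (s + t)) := by
    field_simp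
    ring
  have hs0 : s ≠ 0 := by linarith
  rw [hc]
  refine ⟨fun h0 => ?_, ?_⟩
  · rw [h0] at hne
    field_simp at hne
    simp at hne
    exact hs0 hne
  · rw [hne]
    field_simp
    ring

theorem continuous_pathVector (s : Ioi (1 : ℝ)) :
    Continuous fun t : paramSet s => pathVector s t := by
  have c1 : ∀ t : paramSet s, (t : ℝ) ≠ 0 := fun t => t.2.1.ne
  have c20 : ∀ t : paramSet s, entry20 s t ≠ 0 := fun t => t.2.2.1.ne
  have c40 : ∀ t : paramSet s, entry40 s t ≠ 0 := fun t => t.2.2.2.1.ne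
  have c21 : ∀ t : paramSet s, entry21 s t ≠ 0 := fun t => t.2.2.2.2.1.ne
  have c41 : ∀ t : paramSet s, entry41 s t ≠ 0 := fun t => t.2.2.2.2.2.1.ne
  have c32 : ∀ t : paramSet s, entry32 s t ≠ 0 := fun t => t.2.2.2.2.2.2.1.ne
  have c54 : ∀ t : paramSet s, entry54 s t ≠ 0 := fun t => t.2.2.2.2.2.2.2.ne
  have k20 : Continuous fun t : paramSet s => entry20 s t := by
    unfold entry20
    fun_prop
  have k40 : Continuous fun t : paramSet s => entry40 s t := by
    unfold entry40
    fun_prop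
  have k21 : Continuous fun t : paramSet s => entry21 s t := by
    unfold entry21
    fun_prop (disch := exact c1)
  have k41 : Continuous fun t : paramSet s => entry41 s t := by
    unfold entry41
    fun_prop (disch := exact c1)
  have k32 : Continuous fun t : paramSet s => entry32 s t :=
    ((k20.inv₀ c20).add (continuous_const.mul (k21.inv₀ c21))).add continuous_const
  have k54 : Continuous fun t : paramSet s => entry54 s t :=
    ((continuous_const.mul (k40.inv₀ c40)).add (k41.inv₀ c41)).add continuous_const
  have l1 := continuous_subtype_val.inv₀ c1
  have l20 := k20.inv₀ c20
  have l40 := k40.inv₀ c40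
  have l21 := k21.inv₀ c21
  have l41 := k41.inv₀ c41
  have l32 := k32.inv₀ c32
  have l54 := k54.inv₀ c54
  refine continuous_pi fun j => continuous_pi fun i => ?_
  fin_cases j <;> fin_cases i <;> simp [pathVector] <;> fun_prop

/-- The fiber over `gammaPath s` is the set of admissible parameters. -/
theorem fiberParametrizedBy_paramSet (s : Ioi (1 : ℝ)) :
    FiberParametrizedBy s (Quotient.mk _ (pathRealization s)) (paramSet s) := by
  let u : fiber (Quotient.mk _ (pathRealization s)) → ℝ := fun c =>
    cyclicProduct (orbitMap exampleG c.1)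
  let G : paramSet s → fiber (Quotient.mk _ (pathRealization s)) := fun t =>
    ⟨Quotient.mk _ (pathCoxeter s t), rfl⟩
  have hG : Function.Surjective G := by
    rintro ⟨c, hc⟩
    induction c using Quotient.inductionOn with
    | _ X =>
      obtain ⟨t, ht⟩ := exists_pathCoxeter s (X := X) hc
      exact ⟨t, Subtype.ext ht⟩
  have hGu : ∀ t : paramSet s, u (G t) ≠ 2 ∧
      (t : ℝ) = s * (1 - 2 * u (G t)) / (2 * (u (G t) - 2)) := by
    intro t
    change cyclicProduct (orbitMap exampleG (Quotient.mk _ (pathCoxeter s t))) ≠ 2 ∧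
      (t : ℝ) = s * (1 - 2 * cyclicProduct (orbitMap exampleG (Quotient.mk _ (pathCoxeter s t)))) /
        (2 * (cyclicProduct (orbitMap exampleG (Quotient.mk _ (pathCoxeter s t))) - 2))
    rw [orbitMap_pathCoxeter]
    exact cyclicProduct_pathVector s.2 t.2
  have hu : ∀ c, u c ≠ 2 := fun c => by
    obtain ⟨t, rfl⟩ := hG c
    exact (hGu t).1
  have hmem : ∀ c, s * (1 - 2 * u c) / (2 * (u c - 2)) ∈ paramSet s := fun c => by
    obtain ⟨t, rfl⟩ := hG c
    rw [← (hGu t).2]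
    exact t.2
  have hucont : Continuous u :=
    continuous_cyclicProduct.comp (continuous_induced_dom.comp continuous_subtype_val)
  have hGcont : Continuous G := by
    refine Continuous.subtype_mk (continuous_induced_rng.2 ?_) _
    have : (orbitMap exampleG ∘ fun t : paramSet s => Quotient.mk _ (pathCoxeter s t)) =
        fun t : paramSet s => Quotient.mk (pairSetoid 6) (gammaPath s, pathVector s t) :=
      funext fun t => orbitMap_pathCoxeter s t
    rw [this]
    exact continuous_quot_mk.comp (continuous_const.prodMk (continuous_pathVector s))
  refine ⟨{
    toFun := fun c => ⟨_, hmem c⟩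
    invFun := G
    left_inv := fun c => by
      obtain ⟨t, rfl⟩ := hG c
      exact congrArg G (Subtype.ext (hGu t).2.symm)
    right_inv := fun t => Subtype.ext (hGu t).2.symm
    continuous_toFun := by
      refine Continuous.subtype_mk (Continuous.div (by fun_prop) (by fun_prop) fun c => ?_) _
      exact mul_ne_zero two_ne_zero (sub_ne_zero.2 (hu c))
    continuous_invFun := hGcont }, fun c => ?_⟩
  obtain ⟨t, rfl⟩ := hG c
  refine ⟨pathVector s t, orbitMap_pathCoxeter s t, ?_⟩
  exact (hGu t).2

/-! ### The admissible parameters -/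

/-- The quadratic polynomial with the sign of `-entry32`. -/
def quad1 (s t : ℝ) : ℝ := 28 * t ^ 2 + (36 * s - 4) * t + 8 * s ^ 2 - s

/-- The quadratic polynomial with the sign of `-entry54`. -/
def quad2 (s t : ℝ) : ℝ := 33 * t ^ 2 + (50 * s - 22) * t + 14 * s ^ 2 - 13 * s + 3

theorem neg_iff_of_mul_eq {x p q : ℝ} (hp : 0 < p) (h : x * p = -q) : x < 0 ↔ 0 < q := by
  constructor
  · intro hx
    have := mul_neg_of_neg_of_pos hx hp
    linarith
  · intro hq
    by_contra! hx
    have := mul_nonneg hx hp.le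
    linarith

/-- Denominators are cleared with factors of known sign. The bound `s ≤ 2` makes two conditions
redundant: `(2 - 4s)/3 ≥ -s` takes care of `entry20`, and `t < -s/4` of `entry41`. -/
theorem mem_paramSet_iff {s t : ℝ} (hs : 1 < s) (hs2 : s ≤ 2) : t ∈ paramSet s ↔
    (2 - 4 * s) / 3 < t ∧ t < -s / 4 ∧ 0 < quad1 s t ∧ 0 < quad2 s t := by
  have h40 : entry40 s t < 0 ↔ (2 - 4 * s) / 3 < t := by
    unfold entry40
    constructor <;> intro h <;> linarith
  have h21 : t < 0 → (entry21 s t < 0 ↔ t < -s / 4) := by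
    intro ht
    have ht0 := ht.ne
    have e : entry21 s t = (-2 * s - 8 * t) / t := by
      unfold entry21
      field_simp
    rw [e, div_lt_iff_of_neg ht]
    constructor <;> intro h <;> linarith
  have h41 : t < 0 → (entry41 s t < 0 ↔ 0 < 1 - 2 * s - 6 * t) := by
    intro ht
    have ht0 := ht.ne
    have e : entry41 s t = (1 - 2 * s - 6 * t) / t := by
      unfold entry41
      field_simp
    rw [e, div_lt_iff_of_neg ht, zero_mul]
  have h32 : t < 0 → entry20 s t < 0 → entry21 s t < 0 → (entry32 s t < 0 ↔ 0 < quad1 s t) := by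
    intro ht h h'
    have ht0 := ht.ne
    have h0 := h.ne
    have h0' := h'.ne
    have e : entry32 s t * (entry20 s t * entry21 s t * -t) = -(2 * quad1 s t) := by
      have e1 : entry32 s t * (entry20 s t * entry21 s t * -t) =
          -t * (entry21 s t + 2 * entry20 s t + 2 * entry20 s t * entry21 s t) := by
        rw [entry32]
        field_simp
      have e2 : t * entry21 s t = -2 * s - 8 * t := by
        rw [entry21]
        field_simp
      rw [e1, quad1, entry20]
      linear_combination (-1 + 8 * (s + t)) * e2
    have hpos : 0 < entry20 s t * entry21 s t * -t :=
      mul_pos (mul_pos_of_neg_of_neg h h') (neg_pos.2 ht)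
    rw [neg_iff_of_mul_eq hpos e]
    constructor <;> intro h <;> linarith
  have h54 : t < 0 → entry40 s t < 0 → entry41 s t < 0 → (entry54 s t < 0 ↔ 0 < quad2 s t) := by
    intro ht h h'
    have ht0 := ht.ne
    have h0 := h.ne
    have h0' := h'.ne
    have e : entry54 s t * (entry40 s t * entry41 s t * -t) = -quad2 s t := by
      have e1 : entry54 s t * (entry40 s t * entry41 s t * -t) =
          -t * ((s - 1) * entry41 s t + entry40 s t + 2 * entry40 s t * entry41 s t) := by
        rw [entry54]
        field_simp
      have e2 : t * entry41 s t = 1 - 2 * s - 6 * t := by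
        rw [entry41]
        field_simp
      rw [e1, quad2]
      have e3 : entry40 s t = 2 - 4 * s - 3 * t := rfl
      rw [e3]
      linear_combination (-(s - 1) - 2 * (2 - 4 * s - 3 * t)) * e2
    have hpos : 0 < entry40 s t * entry41 s t * -t :=
      mul_pos (mul_pos_of_neg_of_neg h h') (neg_pos.2 ht)
    exact neg_iff_of_mul_eq hpos e
  constructor
  · rintro ⟨k1, k2, k3, k4, k5, k6, k7⟩
    exact ⟨h40.1 k3, (h21 k1).1 k4, (h32 k1 k2 k4).1 k6, (h54 k1 k3 k5).1 k7⟩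
  · rintro ⟨k1, k2, k3, k4⟩
    have ht : t < 0 := by linarith
    have k20 : entry20 s t < 0 := by
      unfold entry20
      linarith
    have k21 := (h21 ht).2 k2
    have k41 := (h41 ht).2 (by linarith)
    exact ⟨ht, k20, h40.2 k1, k21, k41, (h32 ht k20 k21).2 k3, (h54 ht (h40.2 k1) k41).2 k4⟩

/-- The right end is the smaller root of `quad1`. Being below it means lying left of the axis of the
parabola with a positive value; completing the square replaces the root by these two conditions. -/
theorem mem_firstInterval_iff {s t : ℝ} : t ∈ firstInterval s ↔
    (2 - 4 * s) / 3 < t ∧ 0 < 1 - 9 * s - 14 * t ∧ 0 < quad1 s t := by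
  refine and_congr_right fun _ => ?_
  have e : (1 - 9 * s - 14 * t) ^ 2 = (1 - 11 * s + 25 * s ^ 2) + 7 * quad1 s t := by
    unfold quad1
    ring
  constructor
  · intro h
    have h' : √(1 - 11 * s + 25 * s ^ 2) < 1 - 9 * s - 14 * t := by linarith
    have hpos := (Real.sqrt_nonneg _).trans_lt h'
    rw [Real.sqrt_lt' hpos, e] at h'
    exact ⟨hpos, by linarith⟩
  · rintro ⟨hpos, h⟩
    have h' : √(1 - 11 * s + 25 * s ^ 2) < 1 - 9 * s - 14 * t := by
      rw [Real.sqrt_lt' hpos, e]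
      linarith
    linarith

theorem mem_secondInterval_iff {s t : ℝ} : t ∈ secondInterval s ↔
    t < -s / 4 ∧ 0 < 33 * t + 25 * s - 11 ∧ 0 < quad2 s t := by
  rw [secondInterval, mem_Ioo, and_comm]
  refine and_congr_right fun _ => ?_
  have e : (33 * t + 25 * s - 11) ^ 2 = (22 - 121 * s + 163 * s ^ 2) + 33 * quad2 s t := by
    unfold quad2
    ring
  constructor
  · intro h
    have h' : √(22 - 121 * s + 163 * s ^ 2) < 33 * t + 25 * s - 11 := by linarith
    have hpos := (Real.sqrt_nonneg _).trans_lt h'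
    rw [Real.sqrt_lt' hpos, e] at h'
    exact ⟨hpos, by linarith⟩
  · rintro ⟨hpos, h⟩
    have h' : √(22 - 121 * s + 163 * s ^ 2) < 33 * t + 25 * s - 11 := by
      rw [Real.sqrt_lt' hpos, e]
      linarith
    linarith

/-- The smaller roots of the two polynomials, and the larger roots, interlace. -/
theorem exists_separators {s : ℝ} (hs : 1 < s) (hs2 : s ≤ 2) : ∃ a b c : ℝ,
    quad1 s a < 0 ∧ 0 < quad2 s a ∧ 33 * a + 25 * s - 11 < 0 ∧
    quad1 s b < 0 ∧ quad2 s b < 0 ∧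
    0 < quad1 s c ∧ quad2 s c < 0 ∧ 1 - 9 * s - 14 * c < 0 := by
  unfold quad1 quad2
  -- Affine functions of `s` chosen to fit on all of `1 < s ≤ 2`: `a` lies between the two smaller
  -- roots, `b` between the roots of both polynomials, and `c` between the two larger roots.
  refine ⟨1 / 4 - 26 / 25 * s, -9 / 20 * s, 9 / 100 - 13 / 40 * s, ?_, ?_, ?_, ?_, ?_, ?_, ?_,
    ?_⟩ <;>
  nlinarith

theorem paramSet_eq {s : ℝ} (hs : 1 < s) (hs2 : s ≤ 2) :
    paramSet s = firstInterval s ∪ secondInterval s := by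
  obtain ⟨a, b, c, ha1, ha2, ha, hb1, hb2, hc1, hc2, hc⟩ := exists_separators hs hs2
  have diff1 : ∀ t u, quad1 s t - quad1 s u = (t - u) * (28 * (t + u) + 36 * s - 4) := by
    intro t u
    unfold quad1
    ring
  have diff2 : ∀ t u, quad2 s t - quad2 s u = (t - u) * (33 * (t + u) + 50 * s - 22) := by
    intro t u
    unfold quad2
    ring
  ext t
  rw [mem_union, mem_paramSet_iff hs hs2, mem_firstInterval_iff, mem_secondInterval_iff]
  constructor
  · rintro ⟨h1, h2, h3, h4⟩
    by_cases h5 : 0 < 1 - 9 * s - 14 * t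
    · exact Or.inl ⟨h1, h5, h3⟩
    by_cases h6 : 0 < 33 * t + 25 * s - 11
    · exact Or.inr ⟨h2, h6, h4⟩
    -- Here `t` lies between the two axes or on them. Comparison with `b`, where both polynomials
    -- are negative, shows that `quad1` is negative at `t` if `t ≤ b`, and `quad2` if `b ≤ t`.
    exfalso
    have d1 := diff1 t b
    have d2 := diff2 t b
    rcases le_total t b with h | h
    · have : 0 ≤ 28 * (t + b) + 36 * s - 4 := by linarith
      nlinarith
    · have : 33 * (t + b) + 50 * s - 22 ≤ 0 := by linarith
      nlinarith
  · rintro (⟨h1, h2, h3⟩ | ⟨h1, h2, h3⟩)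
    -- Left of its axis `quad1` decreases, so `t < a`; then `quad2` is still larger at `t` than its
    -- positive value at `a`. The second interval is treated symmetrically with `c`.
    · have hta : t < a := by
        by_contra! h
        have d1 := diff1 t a
        have : 28 * (t + a) + 36 * s - 4 ≤ 0 := by linarith
        nlinarith
      refine ⟨h1, by linarith, h3, ?_⟩
      have d2 := diff2 t a
      have : 33 * (t + a) + 50 * s - 22 ≤ 0 := by linarith
      nlinarith
    · have hct : c < t := by
        by_contra! h
        have d2 := diff2 t c
        have : 0 ≤ 33 * (t + c) + 50 * s - 22 := by linarith
        nlinarith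
      refine ⟨by linarith, h1, ?_, h3⟩
      have d1 := diff1 t c
      have : 0 ≤ 28 * (t + c) + 36 * s - 4 := by linarith
      nlinarith

/-- `sEmpty` is the larger root of this quadratic; the roots have product 1, so the smaller one is
below 1. Up to a factor 9 the quadratic is the value of `quad1` at the left end `(2 - 4s)/3`. -/
theorem sEmpty_lt_iff {s : ℝ} (hs : 1 < s) : sEmpty < s ↔ 0 < 88 * s ^ 2 - 193 * s + 88 := by
  have h0 := Real.sqrt_nonneg 697
  have h1 : √697 * √697 = 697 := Real.mul_self_sqrt (by norm_num)
  have e : sEmpty < s ↔ 3 * √697 < 176 * s - 193 := by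
    unfold sEmpty
    constructor <;> intro h <;> linarith
  rw [e]
  constructor
  · intro h
    nlinarith
  · intro h
    by_contra! h'
    have : 0 ≤ 3 * √697 + (176 * s - 193) := by nlinarith
    nlinarith

theorem sJump_lt_iff {s : ℝ} (hs : 1 < s) : sJump < s ↔ 0 < 19 * s ^ 2 - 40 * s + 16 := by
  have h0 := Real.sqrt_nonneg 6
  have h1 : √6 * √6 = 6 := Real.mul_self_sqrt (by norm_num)
  have e : sJump < s ↔ 4 * √6 < 19 * s - 20 := by
    unfold sJump
    constructor <;> intro h <;> linarith
  rw [e]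
  constructor
  · intro h
    nlinarith
  · intro h
    by_contra! h'
    have : 0 ≤ 4 * √6 + (19 * s - 20) := by nlinarith
    nlinarith

theorem firstInterval_nonempty_iff {s : ℝ} (hs : 1 < s) :
    (firstInterval s).Nonempty ↔ sEmpty < s := by
  rw [sEmpty_lt_iff hs]
  have hq : 9 * quad1 s ((2 - 4 * s) / 3) = 88 * s ^ 2 - 193 * s + 88 := by
    unfold quad1
    ring
  have diff1 : ∀ t u, quad1 s t - quad1 s u = (t - u) * (28 * (t + u) + 36 * s - 4) := by
    intro t u
    unfold quad1
    ring
  constructor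
  · rintro ⟨t, ht⟩
    obtain ⟨h1, h2, h3⟩ := mem_firstInterval_iff.1 ht
    have d := diff1 t ((2 - 4 * s) / 3)
    have : 28 * (t + (2 - 4 * s) / 3) + 36 * s - 4 ≤ 0 := by linarith
    nlinarith
  · intro h
    refine nonempty_Ioo.2 ?_
    have e : (1 - 9 * s - 14 * ((2 - 4 * s) / 3)) ^ 2 =
        (1 - 11 * s + 25 * s ^ 2) + 7 * quad1 s ((2 - 4 * s) / 3) := by
      unfold quad1
      ring
    have h' : √(1 - 11 * s + 25 * s ^ 2) < 1 - 9 * s - 14 * ((2 - 4 * s) / 3) := by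
      rw [Real.sqrt_lt' (by linarith), e]
      linarith
    linarith

/-- The right end `-s/4` is to the right of the axis of `quad2`, so it exceeds the larger root
exactly when `quad2` is positive there. `sJump` is the value of `s > 1` at which it vanishes. -/
theorem secondInterval_nonempty_iff {s : ℝ} (hs : 1 < s) :
    (secondInterval s).Nonempty ↔ sJump < s := by
  rw [sJump_lt_iff hs]
  have hq : 16 * quad2 s (-s / 4) = 3 * (19 * s ^ 2 - 40 * s + 16) := by
    unfold quad2
    ring
  have diff2 : ∀ t u, quad2 s t - quad2 s u = (t - u) * (33 * (t + u) + 50 * s - 22) := by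
    intro t u
    unfold quad2
    ring
  constructor
  · rintro ⟨t, ht⟩
    obtain ⟨h1, h2, h3⟩ := mem_secondInterval_iff.1 ht
    have d := diff2 t (-s / 4)
    have : 0 ≤ 33 * (t + -s / 4) + 50 * s - 22 := by linarith
    nlinarith
  · intro h
    refine nonempty_Ioo.2 ?_
    have e : (33 * (-s / 4) + 25 * s - 11) ^ 2 =
        (22 - 121 * s + 163 * s ^ 2) + 33 * quad2 s (-s / 4) := by
      unfold quad2
      ring
    have h' : √(22 - 121 * s + 163 * s ^ 2) < 33 * (-s / 4) + 25 * s - 11 := by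
      rw [Real.sqrt_lt' (by linarith), e]
      linarith
    linarith

/-- The axis of `quad1` is to the left of the axis of `quad2`, and each root lies on the outer side
of its axis. -/
theorem firstInterval_le_secondInterval {s : ℝ} (hs2 : s ≤ 2) :
    (1 - 9 * s) / 14 - √(1 - 11 * s + 25 * s ^ 2) / 14 ≤
      (11 - 25 * s) / 33 + √(22 - 121 * s + 163 * s ^ 2) / 33 := by
  have := Real.sqrt_nonneg (1 - 11 * s + 25 * s ^ 2)
  have := Real.sqrt_nonneg (22 - 121 * s + 163 * s ^ 2)
  linarith

theorem one_lt_sEmpty : 1 < sEmpty := by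
  have := Real.sqrt_nonneg 697
  unfold sEmpty
  linarith

theorem sEmpty_lt_sJump : sEmpty < sJump := by
  have h1 : √697 < 27 := (Real.sqrt_lt' (by norm_num)).2 (by norm_num)
  have h2 : 12 / 5 < √6 := (Real.lt_sqrt (by norm_num)).2 (by norm_num)
  unfold sEmpty sJump
  linarith

theorem sJump_lt_two : sJump < 2 := by
  have h1 : √6 < 3 := (Real.sqrt_lt' (by norm_num)).2 (by norm_num)
  unfold sJump
  linarith

/-! ### Connected components -/

/-- A map to a totally disconnected space is constant on components, and connected fibers cannot
meet two of them; so components correspond to points of `Y`. -/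
theorem card_connectedComponents {X Y : Type*} [TopologicalSpace X] [TopologicalSpace Y]
    [TotallyDisconnectedSpace Y] {f : X → Y} (hf : Continuous f) (hsurj : Function.Surjective f)
    (hfib : ∀ y, IsPreconnected (f ⁻¹' {y})) :
    Nat.card (ConnectedComponents X) = Nat.card Y := by
  refine Nat.card_congr (Equiv.ofBijective hf.connectedComponentsLift ⟨?_, ?_⟩)
  · intro a b hab
    obtain ⟨x, rfl⟩ := ConnectedComponents.surjective_coe a
    obtain ⟨y, rfl⟩ := ConnectedComponents.surjective_coe b
    simp only [Continuous.connectedComponentsLift_apply_coe] at hab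
    exact (ConnectedComponents.coe_eq_coe'.2
      ((hfib (f y)).subset_connectedComponent (x := y) rfl hab))
  · intro y
    obtain ⟨x, rfl⟩ := hsurj y
    exact ⟨x, hf.connectedComponentsLift_apply_coe x⟩

theorem card_connectedComponents_Ioo {X : Type*} [TopologicalSpace X] {a b : ℝ}
    (h : X ≃ₜ Ioo a b) (hne : (Ioo a b).Nonempty) : Nat.card (ConnectedComponents X) = 1 := by
  have : ConnectedSpace (Ioo a b) :=
    isConnected_iff_connectedSpace.1 (isConnected_Ioo (nonempty_Ioo.1 hne))
  have : ConnectedSpace X := h.symm.surjective.connectedSpace h.symm.continuous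
  rw [card_connectedComponents (Y := Unit) (f := fun _ => ()) continuous_const
    (fun _ => ⟨Classical.arbitrary X, rfl⟩) fun _ => by
      simpa using isPreconnected_univ, Nat.card_unique]

theorem card_connectedComponents_union {X : Type*} [TopologicalSpace X] {a b c d : ℝ}
    (h : X ≃ₜ ↥(Ioo a b ∪ Ioo c d)) (hab : (Ioo a b).Nonempty) (hcd : (Ioo c d).Nonempty)
    (hbc : b ≤ c) : Nat.card (ConnectedComponents X) = 2 := by
  classical
  have hcases : ∀ x : X, (h x : ℝ) < b ∧ (h x : ℝ) ∈ Ioo a b ∨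
      c < (h x : ℝ) ∧ (h x : ℝ) ∈ Ioo c d := fun x =>
    (h x).2.imp (fun h => ⟨h.2, h⟩) fun h => ⟨h.1, h⟩
  have hcont : Continuous fun x => (h x : ℝ) := continuous_subtype_val.comp h.continuous
  have hopen : ∀ {A : Set ℝ}, A ⊆ Ioo a b ∪ Ioo c d → IsPreconnected A →
      IsPreconnected ((fun x => (h x : ℝ)) ⁻¹' A) := by
    intro A hA hpre
    change IsPreconnected (h ⁻¹' (Subtype.val ⁻¹' A))
    rw [h.isPreconnected_preimage, ← IsInducing.subtypeVal.isPreconnected_image,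
      Subtype.image_preimage_coe, inter_eq_right.2 hA]
    exact hpre
  have hpre : ∀ x, ((h x : ℝ) < b ↔ (h x : ℝ) ∈ Ioo a b) ∧
      (¬ (h x : ℝ) < b ↔ (h x : ℝ) ∈ Ioo c d) := by
    intro x
    have h1 : ∀ y : ℝ, y ∈ Ioo a b → y < b := fun y hy => hy.2
    have h2 : ∀ y : ℝ, y ∈ Ioo c d → ¬ y < b := fun y hy => not_lt.2 (hbc.trans hy.1.le)
    have := h1 (h x)
    have := h2 (h x)
    have := hcases x
    tauto
  have htrue : (fun x => decide ((h x : ℝ) < b)) ⁻¹' {true} = (fun x => (h x : ℝ)) ⁻¹' Ioo a b := by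
    ext x
    simpa using (hpre x).1
  have hfalse : (fun x => decide ((h x : ℝ) < b)) ⁻¹' {false} =
      (fun x => (h x : ℝ)) ⁻¹' Ioo c d := by
    ext x
    simpa using (hpre x).2
  rw [card_connectedComponents (f := fun x => decide ((h x : ℝ) < b)), Nat.card_eq_fintype_card,
    Fintype.card_bool]
  · refine (continuous_bool_rng true).2 ⟨?_, ?_⟩
    · rw [← isOpen_compl_iff, ← preimage_compl, Bool.compl_singleton, Bool.not_true, hfalse]
      exact isOpen_Ioo.preimage hcont
    · rw [htrue]
      exact isOpen_Ioo.preimage hcont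
  · rintro (_ | _)
    · obtain ⟨y, hy⟩ := hcd
      refine ⟨h.symm ⟨y, Or.inr hy⟩, ?_⟩
      have : h.symm ⟨y, Or.inr hy⟩ ∈ (fun x => (h x : ℝ)) ⁻¹' Ioo c d := by simpa using hy
      rwa [← hfalse] at this
    · obtain ⟨y, hy⟩ := hab
      refine ⟨h.symm ⟨y, Or.inl hy⟩, ?_⟩
      have : h.symm ⟨y, Or.inl hy⟩ ∈ (fun x => (h x : ℝ)) ⁻¹' Ioo a b := by simpa using hy
      rwa [← htrue] at this
  · rintro (_ | _)
    · rw [hfalse]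
      exact hopen subset_union_right isPreconnected_Ioo
    · rw [htrue]
      exact hopen subset_union_left isPreconnected_Ioo

/-- The point of the realization space given by `gammaPath s`. -/
def pathClass (s : Ioi (1 : ℝ)) : RealizationSpace exampleG := Quotient.mk _ (pathRealization s)

/-! ### Fibers over the path, non-surjectivity and failure of local triviality -/

theorem paramSet_nonempty_iff {s : ℝ} (hs : 1 < s) (hs2 : s ≤ 2) :
    (paramSet s).Nonempty ↔ sEmpty < s := by
  rw [paramSet_eq hs hs2, union_nonempty, firstInterval_nonempty_iff hs,
    secondInterval_nonempty_iff hs]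
  exact or_iff_left_of_imp sEmpty_lt_sJump.trans

theorem fiber_pathClass_nonempty_iff {s : Ioi (1 : ℝ)} (hs2 : (s : ℝ) ≤ 2) :
    (fiber (pathClass s)).Nonempty ↔ sEmpty < s := by
  obtain ⟨h, -⟩ := fiberParametrizedBy_paramSet s
  rw [← paramSet_nonempty_iff s.2 hs2, ← nonempty_coe_sort, ← nonempty_coe_sort]
  exact h.toEquiv.nonempty_congr

theorem paramSet_eq_firstInterval {s : ℝ} (hs : 1 < s) (hs2 : s ≤ sJump) :
    paramSet s = firstInterval s := by
  have : secondInterval s = ∅ := by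
    rw [← not_nonempty_iff_eq_empty, secondInterval_nonempty_iff hs, not_lt]
    exact hs2
  rw [paramSet_eq hs (hs2.trans sJump_lt_two.le), this, union_empty]

theorem fiberParametrizedBy_firstInterval {s : Ioi (1 : ℝ)} (hs : (s : ℝ) ≤ sJump) :
    FiberParametrizedBy s (pathClass s) (firstInterval s) := by
  rw [← paramSet_eq_firstInterval s.2 hs]
  exact fiberParametrizedBy_paramSet s

theorem fiberParametrizedBy_union {s : Ioi (1 : ℝ)} (hs : (s : ℝ) ≤ 2) :
    FiberParametrizedBy s (pathClass s) (firstInterval s ∪ secondInterval s) := by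
  rw [← paramSet_eq s.2 hs]
  exact fiberParametrizedBy_paramSet s

theorem card_connectedComponents_eq_one {s : Ioi (1 : ℝ)} (h1 : sEmpty < s)
    (h2 : (s : ℝ) ≤ sJump) {X : Type*} [TopologicalSpace X] (e : X ≃ₜ fiber (pathClass s)) :
    Nat.card (ConnectedComponents X) = 1 := by
  obtain ⟨h, -⟩ := fiberParametrizedBy_firstInterval h2
  exact card_connectedComponents_Ioo (e.trans h) ((firstInterval_nonempty_iff s.2).2 h1)

theorem card_connectedComponents_eq_two {s : Ioi (1 : ℝ)} (h1 : sJump < s)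
    (h2 : (s : ℝ) ≤ 2) {X : Type*} [TopologicalSpace X] (e : X ≃ₜ fiber (pathClass s)) :
    Nat.card (ConnectedComponents X) = 2 := by
  obtain ⟨h, -⟩ := fiberParametrizedBy_union h2
  exact card_connectedComponents_union (e.trans h)
    ((firstInterval_nonempty_iff s.2).2 (sEmpty_lt_sJump.trans h1))
    ((secondInterval_nonempty_iff s.2).2 h1) (firstInterval_le_secondInterval h2)

theorem not_surjective_forget : ¬ Function.Surjective (forget exampleG) := by
  intro h
  have h2 : sEmpty ≤ 2 := (sEmpty_lt_sJump.trans sJump_lt_two).le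
  obtain ⟨c, hc⟩ := h (pathClass ⟨sEmpty, one_lt_sEmpty⟩)
  exact ((fiber_pathClass_nonempty_iff (s := ⟨sEmpty, one_lt_sEmpty⟩) h2).1 ⟨c, hc⟩).false

/-- The fibers over a trivializing set are homeomorphic. -/
noncomputable def fiberHomeomorph {X Y F : Type} [TopologicalSpace X] [TopologicalSpace Y]
    [TopologicalSpace F] {π : X → Y} (e : Bundle.Trivialization F (rangeFactorization π))
    {b : range π} (hb : b ∈ e.baseSet) : π ⁻¹' {b.1} ≃ₜ F :=
  (Homeomorph.setCongr (by
    ext x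
    exact (Subtype.ext_iff (a1 := rangeFactorization π x) (a2 := b)).symm)).trans
    (e.preimageSingletonHomeomorph hb)

theorem not_isFiberBundleOverImage_forget : ¬ IsFiberBundleOverImage (forget exampleG) := by
  intro h
  let J := Icc sJump 2
  have hJ : ∀ s : J, 1 < (s : ℝ) := fun s =>
    (one_lt_sEmpty.trans sEmpty_lt_sJump).trans_le s.2.1
  have hrange : ∀ s : J, pathClass ⟨s, hJ s⟩ ∈ range (forget exampleG) := fun s =>
    (fiber_pathClass_nonempty_iff (s := ⟨s, hJ s⟩) s.2.2).2 (sEmpty_lt_sJump.trans_le s.2.1)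
  -- The path over `[sJump, 2]` stays in the image. Extending it by constants to the real line lets
  -- every neighborhood of the point at `sJump` be pulled back to a neighborhood of `sJump`, which
  -- contains some `s > sJump`.
  let q : ℝ → range (forget exampleG) := fun x =>
    ⟨pathClass ⟨projIcc sJump 2 sJump_lt_two.le x, hJ _⟩, hrange _⟩
  have hq : Continuous q := by
    refine Continuous.subtype_mk (continuous_quot_mk.comp (continuous_pathRealization.comp ?_)) _
    exact Continuous.subtype_mk (continuous_subtype_val.comp continuous_projIcc) _
  obtain ⟨F, _, e, he⟩ := h (q sJump)
  have hnhds : q ⁻¹' e.baseSet ∈ 𝓝[>] sJump :=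
    nhdsWithin_le_nhds ((e.open_baseSet.preimage hq).mem_nhds he)
  obtain ⟨s, hs, hs1, hs2⟩ := Filter.nonempty_of_mem
    (Filter.inter_mem hnhds (Ioc_mem_nhdsGT sJump_lt_two))
  have hval : ∀ x (hx : x ∈ J), (q x).1 = pathClass ⟨x, hJ ⟨x, hx⟩⟩ := fun x hx => by
    change pathClass ⟨projIcc sJump 2 sJump_lt_two.le x, _⟩ = _
    congr 2
    exact congrArg Subtype.val (projIcc_of_mem sJump_lt_two.le hx)
  have e₀ := fiberHomeomorph e he
  have e₁ := fiberHomeomorph e hs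
  rw [hval _ ⟨le_rfl, sJump_lt_two.le⟩] at e₀
  rw [hval _ ⟨hs1.le, hs2⟩] at e₁
  have h1 := card_connectedComponents_eq_one sEmpty_lt_sJump le_rfl e₀.symm
  have h2 := card_connectedComponents_eq_two hs1 hs2 e₁.symm
  omega

end CoxeterDeformation

theorem mainTheorem4 :
    ¬ Function.Surjective (forget exampleG) ∧
    ¬ IsFiberBundleOverImage (forget exampleG) ∧
    ∃ p : Ioi (1 : ℝ) → PreRealization exampleG, Continuous p ∧
      (∀ s : Ioi (1 : ℝ), (p s).DefinedBy (gammaPath s)) ∧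
      (∀ s : Ioi (1 : ℝ), (s : ℝ) ≤ sEmpty →
        fiber (Quotient.mk _ (p s)) = ∅) ∧
      (∀ s : Ioi (1 : ℝ), sEmpty < s → (s : ℝ) ≤ sJump →
        FiberParametrizedBy s (Quotient.mk _ (p s)) (firstInterval s) ∧
        Nat.card (ConnectedComponents (fiber (Quotient.mk _ (p s)))) = 1) ∧
      (∀ s : Ioi (1 : ℝ), sJump < s → (s : ℝ) ≤ 2 →
        FiberParametrizedBy s (Quotient.mk _ (p s)) (firstInterval s ∪ secondInterval s) ∧
        Nat.card (ConnectedComponents (fiber (Quotient.mk _ (p s)))) = 2) := by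
  refine ⟨not_surjective_forget, not_isFiberBundleOverImage_forget, pathRealization,
    continuous_pathRealization, pathRealization_definedBy, fun s hs => ?_, fun s h1 h2 =>
    ⟨fiberParametrizedBy_firstInterval h2, card_connectedComponents_eq_one h1 h2 (.refl _)⟩,
    fun s h1 h2 => ⟨fiberParametrizedBy_union h2,
      card_connectedComponents_eq_two h1 h2 (.refl _)⟩⟩
  rw [← not_nonempty_iff_eq_empty]
  intro hne
  exact ((fiber_pathClass_nonempty_iff (hs.trans
    (sEmpty_lt_sJump.trans sJump_lt_two).le)).1 hne).not_ge hs
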